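/- Let $n\ge 3$, $k\ge 1$, let $m_1,\dots,m_k>0$, and let $G\colon\mathbb{R}^k\to\mathbb{R}$ be continuously differentiable with $G(0)=0$, $$F(z):=G(z)+\tfrac12\sum_{j=1}^k m_j^2z_j^2\ \ge 0\quad\text{for all } z\in\mathbb{R}^k,$$ $$|DG(z)|\le c\,\big(|z|^{p-1}+|z|^{q-1}\big)\quad\text{for all } z\in\mathbb{R}^k,\qquad 2<p\le q<\frac{2n}{n-2},$$ for some constant $c$. Let $H=H^1(\mathbb{R}^n,\mathbb{R}^k)$ with scalar product $(u,v)_H=\sum_j (u_j,v_j)_{H^1}$, and let $H_r\subset H$ be the subspace of those $u$ all of whose components are radial (a.e. equal to a function of $|x|$). For $(u,\omega)\in H\times\mathbb{R}^k$ put $$E(u,\omega)=\frac12\sum_{j=1}^k\int_{\mathbb{R}^n}\Big(|Du_j|^2+(m_j^2+\omega_j^2)u_j^2+\frac2k\,G(u)\Big)\,dx,\qquad C_j(u,\omega)=\omega_j\int_{\mathbb{R}^n}u_j^2\,dx .$$ Let $\sigma\in(0,\infty)^k$ and $$M_\sigma^r=\{(u,\omega)\in H_r\times[0,\infty)^k :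 C_j(u,\omega)=\sigma_j,\ 1\le j\le k\}.$$ Let $(u_i,\omega_i)_{i\in\mathbb{N}}\subset M_\sigma^r$ be a Palais–Smale sequence for $E$ on $M_\sigma^r$, that is, the sequence $E(u_i,\omega_i)$ is bounded and the norm of the restriction of $DE(u_i,\omega_i)$ to the tangent space $$\{(\varphi,\eta)\in H_r\times\mathbb{R}^k : DC_j(u_i,\omega_i)(\varphi,\eta)=0,\ 1\le j\le k\}$$ tends to $0$ as $i\to\infty$. Suppose that $\omega_i\to\omega$ in $\mathbb{R}^k$, where the components of the limit satisfy $\omega^j<m_j$ for all $1\le j\le k$. Then $(u_i)$ has a subsequence that converges strongly in $H^1$ to an element of $H_r$. -/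

import Mathlib

open MeasureTheory Filter Topology
open scoped ENNReal

noncomputable section

namespace EllipticSystem

/-- The space `ℝⁿ` with its Euclidean norm. -/
abbrev Rn (n : ℕ) : Type := EuclideanSpace ℝ (Fin n)

/-- `g` is the weak gradient of `u`: `∫ u ∂_v φ = - ∫ φ ⟨g, v⟩` for every test function
`φ ∈ C_c^∞(ℝⁿ)` and every direction `v`. -/
def IsWeakGradient {n : ℕ} (u : Rn n → ℝ) (g : Rn n → Rn n) : Prop :=
  ∀ φ : Rn n → ℝ, ContDiff ℝ ((⊤ : ℕ∞) : WithTop ℕ∞) φ → HasCompactSupport φ → ∀ v : Rn n,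
    ∫ x, u x * fderiv ℝ φ x v = - ∫ x, φ x * inner ℝ (g x) v

theorem integrable_mul_of_test {n : ℕ} (u : Lp ℝ 2 (volume : Measure (Rn n)))
    {ψ : Rn n → ℝ} (hψ : Continuous ψ) (hc : HasCompactSupport ψ) :
    Integrable (fun x => u x * ψ x) :=
  (Lp.memLp u).integrable_mul (hψ.memLp_of_hasCompactSupport (p := 2) hc)

theorem integrable_mul_inner_of_test {n : ℕ} (g : Lp (Rn n) 2 (volume : Measure (Rn n)))
    {φ : Rn n → ℝ} (hφ : Continuous φ) (hc : HasCompactSupport φ) (v : Rn n) :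
    Integrable (fun x => φ x * inner ℝ (g x) v) :=
  (hφ.memLp_of_hasCompactSupport (p := 2) hc).integrable_mul ((Lp.memLp g).inner_const v)

theorem continuous_fderiv_of_test {n : ℕ} {φ : Rn n → ℝ} (hφ : ContDiff ℝ ((⊤ : ℕ∞) : WithTop ℕ∞) φ) (v : Rn n) :
    Continuous (fun x => fderiv ℝ φ x v) :=
  (hφ.continuous_fderiv (by simp)).clm_apply continuous_const

/-- The scalar Sobolev space `H¹(ℝⁿ)`, realised as the space of all pairs `(u, Du) ∈ L² × L²` where
`Du` is the weak gradient of `u`. The inner product which it inherits from the Hilbert sum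
`L² ⊕ L²` is `(u, v)_{H¹} = ∫ u v + ∫ ⟨Du, Dv⟩`. -/
def sobolevH1 (n : ℕ) : Submodule ℝ
    (WithLp 2 (Lp ℝ 2 (volume : Measure (Rn n)) × Lp (Rn n) 2 (volume : Measure (Rn n)))) where
  carrier := {w | IsWeakGradient (w.fst : Rn n → ℝ) (w.snd : Rn n → Rn n)}
  zero_mem' := by
    intro φ hφ hc v
    have h1 : ∫ x, ((0 : Lp ℝ 2 (volume : Measure (Rn n))) : Rn n → ℝ) x * fderiv ℝ φ x v = 0 := by
      apply integral_eq_zero_of_ae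
      filter_upwards with x
      simp
    have h2 : ∫ x, φ x * inner ℝ
        (((0 : Lp (Rn n) 2 (volume : Measure (Rn n))) : Rn n → Rn n) x) v = 0 := by
      apply integral_eq_zero_of_ae
      filter_upwards with x
      simp
    simp only [WithLp.zero_fst, WithLp.zero_snd]
    rw [h1, h2, neg_zero]
  add_mem' := by
    intro a b ha hb φ hφ hc v
    have hc' : HasCompactSupport (fun x => fderiv ℝ φ x v) := hc.fderiv_apply (𝕜 := ℝ) v
    have hd := continuous_fderiv_of_test hφ v
    have h1 : ∫ x, ((a + b).fst : Rn n → ℝ) x * fderiv ℝ φ x v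
        = ∫ x, (a.fst x * fderiv ℝ φ x v + b.fst x * fderiv ℝ φ x v) := by
      apply integral_congr_ae
      filter_upwards [Lp.coeFn_add a.fst b.fst] with x hx
      simp only [WithLp.add_fst, hx, Pi.add_apply]
      ring
    have h2 : ∫ x, φ x * inner ℝ (((a + b).snd : Rn n → Rn n) x) v
        = ∫ x, (φ x * inner ℝ (a.snd x) v + φ x * inner ℝ (b.snd x) v) := by
      apply integral_congr_ae
      filter_upwards [Lp.coeFn_add a.snd b.snd] with x hx
      simp only [WithLp.add_snd, hx, Pi.add_apply, inner_add_left]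
      ring
    rw [h1, h2, integral_add (integrable_mul_of_test _ hd hc') (integrable_mul_of_test _ hd hc'),
      integral_add (integrable_mul_inner_of_test _ hφ.continuous hc v)
        (integrable_mul_inner_of_test _ hφ.continuous hc v), ha φ hφ hc v, hb φ hφ hc v]
    ring
  smul_mem' := by
    intro c a ha φ hφ hc v
    have h1 : ∫ x, ((c • a).fst : Rn n → ℝ) x * fderiv ℝ φ x v
        = ∫ x, c * (a.fst x * fderiv ℝ φ x v) := by
      apply integral_congr_ae
      filter_upwards [Lp.coeFn_smul c a.fst] with x hx
      simp only [WithLp.smul_fst, hx, Pi.smul_apply, smul_eq_mul]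
      ring
    have h2 : ∫ x, φ x * inner ℝ (((c • a).snd : Rn n → Rn n) x) v
        = ∫ x, c * (φ x * inner ℝ (a.snd x) v) := by
      apply integral_congr_ae
      filter_upwards [Lp.coeFn_smul c a.snd] with x hx
      simp only [WithLp.smul_snd, hx, Pi.smul_apply, real_inner_smul_left]
      ring
    rw [h1, h2, integral_const_mul, integral_const_mul, ha φ hφ hc v]
    ring

/-- The Hilbert space `H = H¹(ℝⁿ, ℝᵏ)` with scalar product `(u, v)_H = ∑ⱼ (uⱼ, vⱼ)_{H¹}`. -/
abbrev H (n k : ℕ) : Type := PiLp 2 (fun _ : Fin k => sobolevH1 n)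

/-- The component `uⱼ` of `u ∈ H`. -/
def comp {n k : ℕ} (u : H n k) (j : Fin k) : Rn n → ℝ := (u j).1.fst

/-- The weak gradient `D uⱼ` of the component `uⱼ`. -/
def gradComp {n k : ℕ} (u : H n k) (j : Fin k) : Rn n → Rn n := (u j).1.snd

/-- The value `u(x) ∈ ℝᵏ`. -/
def val {n k : ℕ} (u : H n k) (x : Rn n) : EuclideanSpace ℝ (Fin k) :=
  WithLp.toLp 2 (fun j => comp u j x)

/-- The subspace `H_r` of the radial elements of `H`: every component agrees almost everywhere with
a function of `|x|`. -/
def radial (n k : ℕ) : Submodule ℝ (H n k) where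
  carrier := {u | ∀ j, ∃ f : ℝ → ℝ, ∀ᵐ x, comp u j x = f ‖x‖}
  zero_mem' := by
    intro j
    refine ⟨0, ?_⟩
    filter_upwards [Lp.coeFn_zero ℝ 2 (volume : Measure (Rn n))] with x hx
    exact hx
  add_mem' := by
    intro a b ha hb j
    obtain ⟨f, hf⟩ := ha j
    obtain ⟨g, hg⟩ := hb j
    refine ⟨f + g, ?_⟩
    filter_upwards [hf, hg, Lp.coeFn_add (a j).1.fst (b j).1.fst] with x hx hy hz
    simp only [comp] at hx hy
    exact hz.trans (congrArg₂ (· + ·) hx hy)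
  smul_mem' := by
    intro c a ha j
    obtain ⟨f, hf⟩ := ha j
    refine ⟨c • f, ?_⟩
    filter_upwards [hf, Lp.coeFn_smul c (a j).1.fst] with x hx hz
    simp only [comp] at hx
    exact hz.trans (congrArg (c • ·) hx)

/-- The space `H × ℝᵏ` of the pairs `(u, ω)`. -/
abbrev Pairs (n k : ℕ) : Type := H n k × EuclideanSpace ℝ (Fin k)

/-- `E(u, ω) = ½ ∑ⱼ ∫ (|Duⱼ|² + (mⱼ² + ωⱼ²) uⱼ² + 2 k⁻¹ G(u))`. -/
def energy {n k : ℕ} (m : Fin k → ℝ) (G : EuclideanSpace ℝ (Fin k) → ℝ) (z : Pairs n k) : ℝ :=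
  1 / 2 * ∑ j, ∫ x, (‖gradComp z.1 j x‖ ^ 2 + (m j ^ 2 + z.2 j ^ 2) * comp z.1 j x ^ 2
    + 2 * (k : ℝ)⁻¹ * G (val z.1 x))

/-- `Cⱼ(u, ω) = ωⱼ ∫ uⱼ²`. -/
def charge {n k : ℕ} (j : Fin k) (z : Pairs n k) : ℝ :=
  z.2 j * ∫ x, comp z.1 j x ^ 2

/-- The radial constraint
`M_σ^r = {(u, ω) : u ∈ H_r, ω ∈ [0, ∞)ᵏ, Cⱼ(u, ω) = σⱼ for all j}`. -/
def constraintRadial (n : ℕ) {k : ℕ} (σ : Fin k → ℝ) : Set (Pairs n k) :=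
  {z | z.1 ∈ radial n k ∧ (∀ j, 0 ≤ z.2 j) ∧ ∀ j, charge j z = σ j}

/-- The tangent space of `M_σ^r` at `z`: the vectors `(φ, η) ∈ H_r × ℝᵏ` with
`DCⱼ(z)(φ, η) = 0` for all `j`. -/
def tangent {n k : ℕ} (z : Pairs n k) : Submodule ℝ (Pairs n k) :=
  (radial n k).prod ⊤ ⊓ ⨅ j : Fin k, (fderiv ℝ (charge (n := n) j) z).ker

/-- `(zᵢ)` is a Palais-Smale sequence for `E` on `M_σ^r`: it lies in `M_σ^r`, the values `E(zᵢ)`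
are bounded, and the norm of the restriction of `DE(zᵢ)` to the tangent space of `M_σ^r` at `zᵢ`
tends to zero. -/
def IsPalaisSmale {n k : ℕ} (m : Fin k → ℝ) (G : EuclideanSpace ℝ (Fin k) → ℝ) (σ : Fin k → ℝ)
    (z : ℕ → Pairs n k) : Prop :=
  (∀ i, z i ∈ constraintRadial n σ) ∧
  (∃ B : ℝ, ∀ i, |energy m G (z i)| ≤ B) ∧
  Tendsto (fun i => ‖(fderiv ℝ (energy m G) (z i)).comp (tangent (z i)).subtypeL‖) atTop (𝓝 0)

end EllipticSystem

end

/-! On the constraint, `ω` can be eliminated. Given a radial `φ`, choose `ηⱼ = -2 ωⱼ (uⱼ, φⱼ) /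
‖uⱼ‖²`. Then `(φ, η)` is tangent, and the `ω`-derivative of `E` turns the coefficient `mⱼ² + ωⱼ²`
into `mⱼ² - ωⱼ²`: the derivative of `E` along `(φ, η)` is `∑ⱼ (Duⱼ, Dφⱼ) + (mⱼ² - ωⱼ²)(uⱼ, φⱼ) + ∫
DG(u) φ`. As `ωⱼ² / ‖uⱼ‖² = ωⱼ³ / σⱼ` and `ω` is bounded along the sequence, `(φ, η)` has norm at
most a fixed multiple of `‖φ‖`. So along the sequence this expression is `o(1) ‖φ‖`
(`exists_bound_firstVariation`), and the assumption on the limit of `ω` makes its quadratic part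
eventually coercive.

Boundedness (`exists_norm_le`): `F ≥ 0` bounds `‖Du‖²` by `2E`, hence also the critical Lebesgue
norm. Since `2 < p ≤ q` are subcritical, `∫ DG(u) u` is at most a small multiple of `‖u‖₂²` plus a
constant, and testing with `φ = u` bounds `‖u‖₂`.

Convergence: pass to a weak limit `u'`, again radial, and test with `w = u - u'`. The potential term
vanishes because radial `H¹` embeds compactly into `Lˢ` for subcritical `s > 2`; replacing `u` by
`u'` in the first slots costs only terms that vanish by weak convergence. What remains is a coercive
quadratic form in `w`, so `w → 0` strongly.

The compact embedding (`tendsto_lintegral_rpow_of_radial`) is proved by mollification instead of a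
pointwise decay estimate. A radial function has the same mass in all balls of radius `ε` whose
centres have the same norm, and far out many of these are disjoint; so its mollification is
uniformly small near infinity. On a bounded ball the mollifications converge pointwise and
boundedly. The mollification error is at most `ε ‖Du‖₂` in `L²`, and large values are controlled by
the critical norm.

The Palais–Smale condition is phrased with `fderiv`, which is zero wherever a function is not
differentiable. Therefore the Fréchet differentiability of `u ↦ ∫ G(u)` on `H` has to be proved
(`exists_hasFDerivAt_potential`). -/

noncomputable section

namespace EllipticSystem

open scoped NNReal

/-! ### Averages in `L²`, translations and mollification -/

section

/-- Jensen's inequality for the square of the norm. -/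
theorem sq_enorm_integral_le {α E : Type*} [MeasurableSpace α] [NormedAddCommGroup E]
    [NormedSpace ℝ E] (ν : Measure α) [IsProbabilityMeasure ν] (f : α → E) :
    ‖∫ y, f y ∂ν‖ₑ ^ 2 ≤ ∫⁻ y, ‖f y‖ₑ ^ 2 ∂ν := by
  by_cases hf : AEStronglyMeasurable f ν
  · have h1 : ‖∫ y, f y ∂ν‖ₑ ≤ eLpNorm f 2 ν := by
      refine (enorm_integral_le_lintegral_enorm f).trans ?_
      rw [← eLpNorm_one_eq_lintegral_enorm]
      exact eLpNorm_le_eLpNorm_of_exponent_le (by norm_num) hf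
    calc ‖∫ y, f y ∂ν‖ₑ ^ 2 ≤ eLpNorm f 2 ν ^ 2 := by gcongr
      _ = _ := by
        have := eLpNorm_nnreal_pow_eq_lintegral (f := f) (μ := ν) (p := 2) (by norm_num)
        simpa using this
  · rw [integral_undef (fun h => hf h.aestronglyMeasurable)]
    simp

theorem eLpNorm_two_sq {α E : Type*} [MeasurableSpace α] [NormedAddCommGroup E]
    (ν : Measure α) (f : α → E) : eLpNorm f 2 ν ^ 2 = ∫⁻ y, ‖f y‖ₑ ^ 2 ∂ν := by
  have := eLpNorm_nnreal_pow_eq_lintegral (f := f) (μ := ν) (p := 2) (by norm_num)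
  simpa using this

theorem le_of_sq_le_sq {a b : ℝ≥0∞} (h : a ^ 2 ≤ b ^ 2) : a ≤ b :=
  (ENNReal.pow_le_pow_left_iff two_ne_zero).1 h

/-- Averaging functions of a parameter does not increase the `L²` norm. -/
theorem eLpNorm_integral_le {α β E : Type*} [MeasurableSpace α] [MeasurableSpace β]
    [NormedAddCommGroup E] [NormedSpace ℝ E] (μ : Measure α) [SFinite μ]
    (ν : Measure β) [IsProbabilityMeasure ν] {f : α → β → E}
    (hf : StronglyMeasurable (Function.uncurry f)) {C : ℝ≥0∞}
    (hC : ∀ᵐ y ∂ν, eLpNorm (fun x => f x y) 2 μ ≤ C) :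
    eLpNorm (fun x => ∫ y, f x y ∂ν) 2 μ ≤ C := by
  apply le_of_sq_le_sq
  rw [eLpNorm_two_sq]
  calc ∫⁻ x, ‖∫ y, f x y ∂ν‖ₑ ^ 2 ∂μ ≤ ∫⁻ x, ∫⁻ y, ‖f x y‖ₑ ^ 2 ∂ν ∂μ :=
        lintegral_mono fun x => sq_enorm_integral_le ν _
    _ = ∫⁻ y, ∫⁻ x, ‖f x y‖ₑ ^ 2 ∂μ ∂ν :=
        lintegral_lintegral_swap (hf.enorm.pow_const 2).aemeasurable
    _ ≤ ∫⁻ _, C ^ 2 ∂ν := by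
        apply lintegral_mono_ae
        filter_upwards [hC] with y hy
        rw [← eLpNorm_two_sq]
        gcongr
    _ = C ^ 2 := by simp

theorem eLpNorm_comp_sub_right {n : ℕ} {E : Type*} [NormedAddCommGroup E] {p : ℝ≥0∞}
    {f : Rn n → E} (hf : AEStronglyMeasurable f) (y : Rn n) :
    eLpNorm (fun x => f (x - y)) p = eLpNorm f p := by
  simp_rw [sub_eq_add_neg]
  exact eLpNorm_comp_measurePreserving (g := f) hf (measurePreserving_add_right volume (-y))

/-- Translation estimate for differentiable functions. -/
theorem eLpNorm_sub_translate_le_of_contDiff {n : ℕ} {f : Rn n → ℝ} (hf : ContDiff ℝ 1 f)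
    (y : Rn n) :
    eLpNorm (fun x => f x - f (x - y)) 2 ≤ ‖y‖ₑ * eLpNorm (fderiv ℝ f) 2 := by
  have hc : Continuous (fderiv ℝ f) := hf.continuous_fderiv (by simp)
  let ν : Measure ℝ := volume.restrict (Set.Ioc 0 1)
  have : IsProbabilityMeasure ν := ⟨by simp [ν]⟩
  -- The increment is an average over `t ∈ (0, 1]` of directional derivatives at translated points,
  -- so `eLpNorm_integral_le` and translation invariance apply.
  have key : ∀ x, f x - f (x - y) = ∫ t, fderiv ℝ f (x - t • y) y ∂ν := by
    intro x
    have h1 : ∀ t ∈ Set.uIcc (0 : ℝ) 1,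
        HasDerivAt (fun t : ℝ => - f (x - t • y)) (fderiv ℝ f (x - t • y) y) t := by
      intro t _
      have h2 : HasDerivAt (fun t : ℝ => x - t • y) (-y) t := by
        simpa using ((hasDerivAt_id t).smul_const y).const_sub x
      have h3 := ((hf.differentiable (by simp)) (x - t • y)).hasFDerivAt.comp_hasDerivAt t h2
      have h4 := h3.neg
      rw [map_neg, neg_neg] at h4
      exact h4
    have h4 := intervalIntegral.integral_eq_sub_of_hasDerivAt h1
      (Continuous.intervalIntegrable (by fun_prop) 0 1)
    rw [intervalIntegral.integral_of_le zero_le_one] at h4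
    rw [h4]
    simp
    ring
  simp_rw [key]
  have hm : Continuous (Function.uncurry fun (x : Rn n) (t : ℝ) => fderiv ℝ f (x - t • y) y) :=
    (hc.comp (continuous_fst.sub (continuous_snd.smul continuous_const))).clm_apply
      continuous_const
  refine eLpNorm_integral_le volume ν hm.stronglyMeasurable ?_
  · filter_upwards with t
    have h1 := eLpNorm_le_mul_eLpNorm_of_ae_le_mul (μ := (volume : Measure (Rn n)))
      (f := fun x => fderiv ℝ f (x - t • y) y)
      (g := fun x => fderiv ℝ f (x - t • y)) (c := ‖y‖) (Eventually.of_forall fun x => by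
        rw [mul_comm]
        exact (fderiv ℝ f (x - t • y)).le_opNorm y) 2
    rw [eLpNorm_comp_sub_right hc.aestronglyMeasurable, ofReal_norm] at h1
    exact h1

/-- The mollification of `f` by the normalised bump function `φ`, written as an average. -/
def moll {n : ℕ} {E : Type*} [NormedAddCommGroup E] [NormedSpace ℝ E]
    (φ : ContDiffBump (0 : Rn n)) (f : Rn n → E) (x : Rn n) : E :=
  ∫ y, φ.normed volume y • f (x - y)

/-- The probability measure with density a normalised bump function. -/
def bumpMeasure {n : ℕ} (φ : ContDiffBump (0 : Rn n)) : Measure (Rn n) :=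
  volume.withDensity fun y => ((φ.normed volume y).toNNReal : ℝ≥0∞)

variable {n : ℕ} {E : Type*} [NormedAddCommGroup E] [NormedSpace ℝ E] (φ : ContDiffBump (0 : Rn n))

instance : IsProbabilityMeasure (bumpMeasure φ) := by
  constructor
  rw [bumpMeasure, withDensity_apply _ MeasurableSet.univ, Measure.restrict_univ]
  have h := ofReal_integral_eq_lintegral_ofReal (φ.integrable_normed (μ := volume))
    (Eventually.of_forall φ.nonneg_normed)
  rw [φ.integral_normed, ENNReal.ofReal_one] at h
  exact h.symm

/-- Writing mollification as an average of translates over a probability measure makes Jensen's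
inequality and `eLpNorm_integral_le` available. -/
theorem moll_eq_integral (f : Rn n → E) (x : Rn n) :
    moll φ f x = ∫ y, f (x - y) ∂(bumpMeasure φ) := by
  rw [bumpMeasure, integral_withDensity_eq_integral_smul
    (φ.continuous_normed.measurable.real_toNNReal), moll]
  congr 1 with y
  rw [NNReal.smul_def, Real.coe_toNNReal _ (φ.nonneg_normed y)]

theorem bumpMeasure_ae : ∀ᵐ y ∂(bumpMeasure φ), ‖y‖ ≤ φ.rOut := by
  rw [bumpMeasure, ae_withDensity_iff (by
    exact (φ.continuous_normed.measurable.real_toNNReal).coe_nnreal_ennreal)]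
  filter_upwards with y hy
  have h1 : y ∈ Function.support (φ.normed volume) := by
    intro h0
    simp [h0] at hy
  rw [φ.support_normed_eq] at h1
  simpa using (Metric.mem_ball.1 h1).le

theorem eLpNorm_moll_le {f : Rn n → E} (hf : StronglyMeasurable f) :
    eLpNorm (moll φ f) 2 ≤ eLpNorm f 2 := by
  have : moll φ f = fun x => ∫ y, f (x - y) ∂(bumpMeasure φ) := funext (moll_eq_integral φ f)
  rw [this]
  apply eLpNorm_integral_le
  · exact hf.comp_measurable (measurable_fst.sub measurable_snd)
  · filter_upwards with y
    exact (eLpNorm_comp_sub_right hf.aestronglyMeasurable y).le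

theorem moll_eq_convolution (f : Rn n → E) :
    moll φ f = convolution (φ.normed volume) f (ContinuousLinearMap.lsmul ℝ ℝ) volume := rfl

theorem contDiff_moll [CompleteSpace E] {f : Rn n → E} (hf : LocallyIntegrable f) :
    ContDiff ℝ 1 (moll φ f) := by
  rw [moll_eq_convolution]
  exact φ.hasCompactSupport_normed.contDiff_convolution_left (n := 1) _ φ.contDiff_normed hf

theorem moll_eq_integral_smul (f : Rn n → E) (x : Rn n) :
    moll φ f x = ∫ y, φ.normed volume (x - y) • f y := by
  rw [moll_eq_convolution]
  exact convolution_lsmul_swap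

end

/-! ### Approximation in `H¹`, the Sobolev inequality and the translation estimate -/

section

variable {n : ℕ} (φ : ContDiffBump (0 : Rn n))

theorem locallyIntegrable_coe {E : Type*} [NormedAddCommGroup E] 
    (u : Lp E 2 (volume : Measure (Rn n))) : LocallyIntegrable (u : Rn n → E) :=
  (Lp.memLp u).locallyIntegrable (by norm_num)

theorem integrable_bump_smul {E : Type*} [NormedAddCommGroup E] [NormedSpace ℝ E]
    (u : Lp E 2 (volume : Measure (Rn n))) (x : Rn n) :
    Integrable (fun y => φ.normed volume (x - y) • u y) := by
  have h : Continuous fun y => φ.normed volume (x - y) :=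
    φ.continuous_normed.comp (continuous_const.sub continuous_id)
  have hc : HasCompactSupport fun y => φ.normed volume (x - y) :=
    φ.hasCompactSupport_normed.comp_homeomorph (Homeomorph.subLeft x)
  exact (locallyIntegrable_coe u).integrable_smul_left_of_hasCompactSupport h hc

/-- The derivative of the mollification is the mollification of the weak gradient. -/
theorem fderiv_moll_apply (w : sobolevH1 n) (x v : Rn n) :
    fderiv ℝ (moll φ w.1.fst) x v = inner ℝ (moll φ w.1.snd x) v := by
  have h1 := φ.hasCompactSupport_normed (μ := volume).hasFDerivAt_convolution_left
    (ContinuousLinearMap.lsmul ℝ ℝ) φ.contDiff_normed (locallyIntegrable_coe w.1.fst) x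
  rw [← moll_eq_convolution] at h1
  have hint := ((φ.hasCompactSupport_normed (μ := volume)).fderiv (𝕜 := ℝ)
    |>.convolutionExists_left ((ContinuousLinearMap.lsmul ℝ ℝ).precompL (Rn n))
      ((φ.contDiff_normed (n := 1)).continuous_fderiv (by simp))
      (locallyIntegrable_coe w.1.fst) x).integrable_swap
  rw [h1.fderiv, convolution_eq_swap, ContinuousLinearMap.integral_apply hint]
  -- The weak gradient is tested with the reflected and translated bump; the minus sign of the chain
  -- rule cancels the one from integration by parts.
  have h2 := w.2 (fun y => φ.normed volume (x - y))
    (φ.contDiff_normed.comp (contDiff_const.sub contDiff_id))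
    (φ.hasCompactSupport_normed.comp_homeomorph (Homeomorph.subLeft x)) v
  have h4 : ∀ y, fderiv ℝ (fun y => φ.normed volume (x - y)) y v
      = - fderiv ℝ (φ.normed volume) (x - y) v := by
    intro y
    have h5 : HasFDerivAt (fun y : Rn n => x - y) (-ContinuousLinearMap.id ℝ (Rn n)) y :=
      (hasFDerivAt_id y).const_sub x
    have h6 := (((φ.contDiff_normed (n := 1) (μ := volume)).differentiable (by simp)
      (x - y)).hasFDerivAt.comp y h5).fderiv
    change fderiv ℝ (φ.normed volume ∘ fun y => x - y) y v = _
    rw [h6]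
    simp
  simp_rw [h4, mul_neg, integral_neg, neg_inj] at h2
  rw [moll_eq_integral_smul, real_inner_comm, ← integral_inner (integrable_bump_smul φ _ x)]
  have h7 : ∀ y, inner ℝ v (φ.normed volume (x - y) • w.1.snd y)
      = φ.normed volume (x - y) * inner ℝ (w.1.snd y) v := fun y => by
    rw [real_inner_smul_right, real_inner_comm]
  simp_rw [h7]
  rw [← h2]
  congr 1 with y
  change fderiv ℝ (φ.normed volume) (x - y) v * w.1.fst y = _
  ring

theorem norm_fderiv_moll_le (w : sobolevH1 n) (x : Rn n) :
    ‖fderiv ℝ (moll φ w.1.fst) x‖ ≤ ‖moll φ w.1.snd x‖ := by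
  refine ContinuousLinearMap.opNorm_le_bound _ (norm_nonneg _) fun v => ?_
  rw [fderiv_moll_apply]
  exact norm_inner_le_norm _ _

/-- A bump function with outer radius `ε`. -/
def bump (n : ℕ) (ε : ℝ) (hε : 0 < ε) : ContDiffBump (0 : Rn n) where
  rIn := ε / 2
  rOut := ε
  rIn_pos := by positivity
  rIn_lt_rOut := by linarith

/-- Product rule. In the application `a` is a mollified `u`, `b` the mollified weak gradient, and
`c` the gradient bound of a cut-off spread over larger and larger balls, so the last term tends to
zero. -/
theorem eLpNorm_fderiv_cutoff_mul_le {χ a : Rn n → ℝ} {b : Rn n → Rn n} (hχ : ContDiff ℝ 1 χ)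
    (hχ1 : ∀ x, |χ x| ≤ 1) {c : ℝ} (hc : ∀ x, ‖fderiv ℝ χ x‖ ≤ c) (ha : ContDiff ℝ 1 a)
    (hb : Continuous b) (hab : ∀ x, ‖fderiv ℝ a x‖ ≤ ‖b x‖) :
    eLpNorm (fderiv ℝ fun x => χ x * a x) 2 ≤ eLpNorm b 2 + ENNReal.ofReal c * eLpNorm a 2 := by
  have hc0 : 0 ≤ c := (norm_nonneg _).trans (hc 0)
  have h0 : ∀ x, ‖fderiv ℝ (fun x => χ x * a x) x‖ ≤ ‖b x‖ + c * ‖a x‖ := by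
    intro x
    rw [fderiv_fun_mul (hχ.differentiable (by simp) x) (ha.differentiable (by simp) x)]
    refine (norm_add_le _ _).trans ?_
    rw [norm_smul, norm_smul]
    have h1 : ‖χ x‖ * ‖fderiv ℝ a x‖ ≤ 1 * ‖b x‖ :=
      mul_le_mul (hχ1 x) (hab x) (norm_nonneg _) zero_le_one
    have h2 : ‖a x‖ * ‖fderiv ℝ χ x‖ ≤ ‖a x‖ * c :=
      mul_le_mul_of_nonneg_left (hc x) (norm_nonneg _)
    linarith
  have h3 : eLpNorm (fderiv ℝ fun x => χ x * a x) 2 ≤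
      eLpNorm ((fun x => ‖b x‖) + fun x => c * ‖a x‖) 2 (volume : Measure (Rn n)) :=
    eLpNorm_mono_real (p := 2) h0
  refine h3.trans ((eLpNorm_add_le hb.norm.aestronglyMeasurable
    (continuous_const.mul ha.continuous.norm).aestronglyMeasurable one_le_two).trans ?_)
  have h4 := eLpNorm_const_smul c (fun x => ‖a x‖) 2 (volume : Measure (Rn n))
  rw [eLpNorm_norm, Real.enorm_of_nonneg hc0] at h4
  rw [eLpNorm_norm, ← h4]
  rfl

/-- Elements of `H¹` are almost everywhere limits of compactly supported `C¹` functions whose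
gradients are asymptotically bounded in `L²` by the weak gradient. -/
theorem exists_contDiff_approx (w : sobolevH1 n) :
    ∃ f : ℕ → Rn n → ℝ, (∀ i, ContDiff ℝ 1 (f i)) ∧ (∀ i, HasCompactSupport (f i)) ∧
      (∀ᵐ x, Tendsto (fun i => f i x) atTop (𝓝 (w.1.fst x))) ∧
      ∀ δ : ℝ≥0, 0 < δ → ∀ᶠ i in atTop,
        eLpNorm (fderiv ℝ (f i)) 2 ≤ eLpNorm (w.1.snd : Rn n → Rn n) 2 + δ := by
  let χ : ContDiffBump (0 : Rn n) := ⟨1, 2, by norm_num, by norm_num⟩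
  have hχc : ContDiff ℝ 1 χ := χ.contDiff
  obtain ⟨K, hK⟩ := (χ.hasCompactSupport.fderiv (𝕜 := ℝ)).exists_bound_of_continuous
    (hχc.continuous_fderiv (by simp))
  have hK0 : 0 ≤ K := (norm_nonneg _).trans (hK 0)
  -- The same null sequence is the mollification radius and the dilation factor of the cut-off,
  -- whose gradient is then `O(ε i)`.
  let ε : ℕ → ℝ := fun i => 1 / ((i : ℝ) + 1)
  have hε : ∀ i, 0 < ε i := fun i => by positivity
  have hε0 : Tendsto ε atTop (𝓝 0) := tendsto_one_div_add_atTop_nhds_zero_nat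
  let φ : ℕ → ContDiffBump (0 : Rn n) := fun i => bump n (ε i) (hε i)
  let χs : ℕ → Rn n → ℝ := fun i x => χ (ε i • x)
  have hχs : ∀ i, ContDiff ℝ 1 (χs i) := fun i => hχc.comp (contDiff_id.const_smul (ε i))
  have hm : ∀ i, ContDiff ℝ 1 (moll (φ i) w.1.fst) := fun i =>
    contDiff_moll _ (locallyIntegrable_coe _)
  have hd : ∀ i x, ‖fderiv ℝ (χs i) x‖ ≤ ε i * K := by
    intro i x
    have h1 : HasFDerivAt (fun x : Rn n => ε i • x) (ε i • ContinuousLinearMap.id ℝ (Rn n)) x :=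
      (hasFDerivAt_id x).const_smul (ε i)
    have h2 := ((hχc.differentiable (by simp) (ε i • x)).hasFDerivAt.comp x h1).fderiv
    change ‖fderiv ℝ (χ ∘ fun x => ε i • x) x‖ ≤ _
    rw [h2, ContinuousLinearMap.comp_smul, norm_smul, Real.norm_of_nonneg (hε i).le,
      ContinuousLinearMap.comp_id]
    exact mul_le_mul_of_nonneg_left (hK _) (hε i).le
  refine ⟨fun i x => χs i x * moll (φ i) w.1.fst x, fun i => (hχs i).mul (hm i), fun i => ?_, ?_, ?_⟩
  · apply HasCompactSupport.mul_right
    exact χ.hasCompactSupport.comp_homeomorph (Homeomorph.smulOfNeZero (ε i) (hε i).ne')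
  -- Lebesgue differentiation needs the ratio of outer to inner radius to stay bounded; `bump` keeps
  -- it equal to `2`.
  · have h := ContDiffBump.ae_convolution_tendsto_right_of_locallyIntegrable (μ := volume)
      (φ := φ) (l := atTop) (K := 2) hε0 (Eventually.of_forall fun i => by
        change ε i ≤ 2 * (ε i / 2)
        linarith) (locallyIntegrable_coe w.1.fst)
    filter_upwards [h] with x hx
    have h1 : Tendsto (fun i => χs i x) atTop (𝓝 1) := by
      have h2 : Tendsto (fun i => ε i • x) atTop (𝓝 0) := by
        simpa using hε0.smul_const x
      have h3 := (hχc.continuous.tendsto 0).comp h2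
      rwa [χ.one_of_mem_closedBall (by simp [χ])] at h3
    have h4 := h1.mul hx
    rw [one_mul] at h4
    exact h4
  · intro δ hδ
    have hA : Tendsto (fun i => ENNReal.ofReal (ε i * K) * eLpNorm (w.1.fst : Rn n → ℝ) 2) atTop
        (𝓝 0) := by
      have h1 : Tendsto (fun i => ENNReal.ofReal (ε i * K)) atTop (𝓝 0) := by
        have := ENNReal.tendsto_ofReal (hε0.mul_const K)
        simpa using this
      have h2 := ENNReal.Tendsto.mul_const h1 (Or.inr (Lp.eLpNorm_ne_top w.1.fst))
      rwa [zero_mul] at h2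
    filter_upwards [hA.eventually_le_const (show (0 : ℝ≥0∞) < δ by exact_mod_cast hδ)] with i hi
    have h1 : ∀ x, |χs i x| ≤ 1 := fun x => by
      rw [abs_of_nonneg χ.nonneg]
      exact χ.le_one
    have h2 : Continuous (moll (φ i) w.1.snd) :=
      (contDiff_moll (φ i) (locallyIntegrable_coe w.1.snd)).continuous
    have h3 := eLpNorm_fderiv_cutoff_mul_le (hχs i) h1 (hd i) (hm i) h2
      (norm_fderiv_moll_le (φ i) w)
    refine h3.trans (add_le_add (eLpNorm_moll_le _ (Lp.stronglyMeasurable _)) (le_trans ?_ hi))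
    exact mul_le_mul_right (eLpNorm_moll_le _ (Lp.stronglyMeasurable _)) _

/-- Absorbs the error `δ` in the gradient bound of `exists_contDiff_approx` when an inequality
passes from `C¹` approximants to `H¹`. -/
theorem le_mul_of_forall_pos_add {a b c : ℝ≥0∞} (hc : c ≠ ∞)
    (h : ∀ δ : ℝ≥0, 0 < δ → a ≤ c * (b + δ)) : a ≤ c * b := by
  have h1 : Tendsto (fun δ : ℝ≥0 => c * (b + (δ : ℝ≥0∞))) (𝓝[>] 0) (𝓝 (c * (b + (0 : ℝ≥0)))) := by
    apply Tendsto.mono_left _ nhdsWithin_le_nhds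
    apply ENNReal.Tendsto.const_mul _ (Or.inr hc)
    exact tendsto_const_nhds.add (ENNReal.tendsto_coe.2 tendsto_id)
  rw [ENNReal.coe_zero, add_zero] at h1
  refine ge_of_tendsto h1 ?_
  filter_upwards [self_mem_nhdsWithin] with δ hδ using h δ hδ

/-- The Sobolev inequality for `H¹(ℝⁿ)`. -/
theorem exists_sobolev_const (hn : 3 ≤ n) : ∃ C : ℝ≥0, ∀ w : sobolevH1 n,
    eLpNorm (w.1.fst : Rn n → ℝ) (ENNReal.ofReal (2 * (n : ℝ) / ((n : ℝ) - 2)))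
      ≤ C * eLpNorm (w.1.snd : Rn n → Rn n) 2 := by
  have hn' : (3 : ℝ) ≤ n := by exact_mod_cast hn
  have hr0 : 0 ≤ 2 * (n : ℝ) / ((n : ℝ) - 2) := div_nonneg (by linarith) (by linarith)
  refine ⟨eLpNormLESNormFDerivOfEqInnerConst (volume : Measure (Rn n)) 2, fun w => ?_⟩
  obtain ⟨f, hf, hfc, hlim, hb⟩ := exists_contDiff_approx w
  refine le_mul_of_forall_pos_add ENNReal.coe_ne_top fun δ hδ => ?_
  refine Lp.eLpNorm_le_of_ae_tendsto ?_ (fun i => (hf i).continuous.aestronglyMeasurable) hlim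
  filter_upwards [hb δ hδ] with i hi
  -- The Gagliardo–Nirenberg–Sobolev inequality for the approximants, with `1/p' = 1/2 - 1/n`; lower
  -- semicontinuity of the norm under a.e. convergence does the rest.
  have h1 := eLpNorm_le_eLpNorm_fderiv_of_eq_inner (volume : Measure (Rn n)) (hf i) (hfc i)
    (p := 2) (p' := (2 * (n : ℝ) / ((n : ℝ) - 2)).toNNReal) (by norm_num)
    (by rw [finrank_euclideanSpace_fin]; omega) (by
      rw [finrank_euclideanSpace_fin, Real.coe_toNNReal _ hr0, NNReal.coe_inv, NNReal.coe_ofNat]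
      have : (n : ℝ) - 2 ≠ 0 := by linarith
      have : (n : ℝ) ≠ 0 := by linarith
      field_simp)
  exact h1.trans (mul_le_mul_right hi _)

/-- The translation estimate for `H¹(ℝⁿ)`. -/
theorem eLpNorm_sub_translate_le (w : sobolevH1 n) (y : Rn n) :
    eLpNorm (fun x => w.1.fst x - w.1.fst (x - y)) 2
      ≤ ‖y‖ₑ * eLpNorm (w.1.snd : Rn n → Rn n) 2 := by
  obtain ⟨f, hf, hfc, hlim, hb⟩ := exists_contDiff_approx w
  refine le_mul_of_forall_pos_add enorm_ne_top fun δ hδ => ?_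
  refine Lp.eLpNorm_le_of_ae_tendsto (u := atTop) (f := fun i x => f i x - f i (x - y)) ?_
    (fun i => ((hf i).continuous.sub
      ((hf i).continuous.comp (continuous_id.sub continuous_const))).aestronglyMeasurable) ?_
  · filter_upwards [hb δ hδ] with i hi
    refine (eLpNorm_sub_translate_le_of_contDiff (hf i) y).trans ?_
    gcongr
  · have hq : MeasurePreserving (fun x : Rn n => x - y) := by
      simp_rw [sub_eq_add_neg]
      exact measurePreserving_add_right volume (-y)
    filter_upwards [hlim, hq.quasiMeasurePreserving.ae hlim] with x h1 h2
    exact h1.sub h2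

/-- Mollification at scale `ε` moves an element of `H¹` by at most `ε ‖Du‖` in `L²`. -/
theorem eLpNorm_sub_moll_le (w : sobolevH1 n) :
    eLpNorm (fun x => w.1.fst x - moll φ w.1.fst x) 2
      ≤ ENNReal.ofReal φ.rOut * eLpNorm (w.1.snd : Rn n → Rn n) 2 := by
  have hm := Lp.stronglyMeasurable w.1.fst
  -- The error is an average of differences of translates over `‖y‖ ≤ rOut`, each bounded by the
  -- translation estimate.
  have h1 : (fun x => w.1.fst x - moll φ w.1.fst x)
      = fun x => ∫ y, (w.1.fst x - w.1.fst (x - y)) ∂(bumpMeasure φ) := by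
    funext x
    have hi : Integrable (fun y => w.1.fst (x - y)) (bumpMeasure φ) := by
      rw [bumpMeasure, integrable_withDensity_iff_integrable_smul
        φ.continuous_normed.measurable.real_toNNReal]
      have h2 := (φ.hasCompactSupport_normed (μ := volume)).convolutionExists_left
        (ContinuousLinearMap.lsmul ℝ ℝ) φ.continuous_normed (locallyIntegrable_coe w.1.fst) x
      refine h2.integrable.congr (Eventually.of_forall fun y => ?_)
      simp only [NNReal.smul_def, Real.coe_toNNReal _ (φ.nonneg_normed y)]
      rfl
    rw [integral_sub (integrable_const _) hi, moll_eq_integral]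
    simp
  rw [h1]
  refine eLpNorm_integral_le volume (bumpMeasure φ) ?_ ?_
  · exact (hm.comp_measurable measurable_fst).sub
      (hm.comp_measurable (measurable_fst.sub measurable_snd))
  · filter_upwards [bumpMeasure_ae φ] with y hy
    refine (eLpNorm_sub_translate_le w y).trans ?_
    gcongr
    rw [← ofReal_norm]
    exact ENNReal.ofReal_le_ofReal hy

end

/-! ### Radial functions: mass far from the origin -/

section

variable {n : ℕ}

/-- Pointwise interpolation between the powers `2` and `r`: the first term suffices for `t ≤ T`, the
second for `t ≥ T`. -/
theorem rpow_le_add_of_pos {t T s r : ℝ} (ht : 0 ≤ t) (hT : 0 < T) (hs : 2 ≤ s) (hsr : s ≤ r) :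
    t ^ s ≤ T ^ (s - 2) * t ^ 2 + T ^ (s - r) * t ^ r := by
  rcases ht.eq_or_lt with rfl | ht
  · rw [Real.zero_rpow (by linarith)]
    positivity
  rcases le_total t T with h | h
  · have h1 : t ^ s = t ^ (s - 2) * t ^ 2 := by
      rw [← Real.rpow_natCast, ← Real.rpow_add ht]
      norm_num
    have h2 : t ^ (s - 2) ≤ T ^ (s - 2) := Real.rpow_le_rpow ht.le h (by linarith)
    have h3 : 0 ≤ T ^ (s - r) * t ^ r := by positivity
    rw [h1]
    nlinarith [mul_le_mul_of_nonneg_right h2 (sq_nonneg t)]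
  · have h1 : t ^ s = t ^ (s - r) * t ^ r := by
      rw [← Real.rpow_add ht]
      norm_num
    have h2 : t ^ (s - r) ≤ T ^ (s - r) :=
      Real.rpow_le_rpow_of_nonpos hT h (by linarith)
    have h3 : 0 ≤ T ^ (s - 2) * t ^ 2 := by positivity
    rw [h1]
    nlinarith [mul_le_mul_of_nonneg_right h2 (Real.rpow_nonneg ht.le r)]

theorem enorm_rpow_eq {E : Type*} [NormedAddCommGroup E] (a : E) {s : ℝ} (hs : 0 ≤ s) :
    ‖a‖ₑ ^ s = ENNReal.ofReal (‖a‖ ^ s) := by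
  rw [← ofReal_norm, ENNReal.ofReal_rpow_of_nonneg (norm_nonneg _) hs]

theorem enorm_sq_eq {E : Type*} [NormedAddCommGroup E] (a : E) :
    ‖a‖ₑ ^ 2 = ENNReal.ofReal (‖a‖ ^ 2) := by
  rw [← ofReal_norm, ENNReal.ofReal_pow (norm_nonneg _)]

/-- A real function on `ℝⁿ` which is almost everywhere a function of `|x|`. -/
def IsRadial (u : Rn n → ℝ) : Prop := ∃ f : ℝ → ℝ, ∀ᵐ x, u x = f ‖x‖

/-- The reflection in the hyperplane orthogonal to `x - y` takes `x` to `y`, preserves Lebesgue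
measure, and leaves radial functions unchanged. -/
theorem IsRadial.setLIntegral_ball_eq {u : Rn n → ℝ} (hu : IsRadial u) {x y : Rn n}
    (hxy : ‖x‖ = ‖y‖) (ε : ℝ) :
    ∫⁻ z in Metric.ball y ε, ‖u z‖ₑ ^ 2 = ∫⁻ z in Metric.ball x ε, ‖u z‖ₑ ^ 2 := by
  obtain ⟨f, hf⟩ := hu
  let L : Rn n ≃ₗᵢ[ℝ] Rn n := (Submodule.span ℝ {x - y})ᗮ.reflection
  have hL : L x = y := Submodule.reflection_sub hxy
  have hm : MeasurePreserving L volume volume := L.measurePreserving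
  have hpre : L ⁻¹' Metric.ball y ε = Metric.ball x ε := by
    ext z
    simp only [Set.mem_preimage, Metric.mem_ball]
    rw [← hL, L.dist_map]
  have h := hm.setLIntegral_comp_preimage_emb L.toHomeomorph.measurableEmbedding
    (fun z => ‖u z‖ₑ ^ 2) (Metric.ball y ε)
  rw [hpre] at h
  rw [← h]
  apply lintegral_congr_ae
  apply ae_restrict_of_ae
  filter_upwards [hf, hm.quasiMeasurePreserving.ae hf] with z h1 h2
  rw [h1, h2, L.norm_map]

/-- The mass of a radial function in a ball of fixed radius tends to zero, uniformly, as the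
ball moves away from the origin. -/
theorem exists_radius_mul_setLIntegral_ball_le (hn : 2 ≤ n) (ε : ℝ) (N : ℕ) :
    ∃ R : ℝ, ∀ x : Rn n, R ≤ ‖x‖ → ∀ u : Rn n → ℝ, Measurable u → IsRadial u →
      N * ∫⁻ z in Metric.ball x ε, ‖u z‖ₑ ^ 2 ≤ ∫⁻ z, ‖u z‖ₑ ^ 2 := by
  -- For `n ≥ 2` the sphere is connected and contains the distinct points `e` and `-e`, hence is
  -- infinite.
  have hinf : (Metric.sphere (0 : Rn n) 1).Infinite := by
    have hrank : 1 < Module.rank ℝ (Rn n) := by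
      rw [← Module.finrank_eq_rank, finrank_euclideanSpace_fin]
      exact_mod_cast hn
    have : Nontrivial (Rn n) := by
      apply Module.nontrivial_of_finrank_pos (R := ℝ)
      rw [finrank_euclideanSpace_fin]
      omega
    obtain ⟨e, he⟩ := (NormedSpace.sphere_nonempty (E := Rn n) (x := 0) (r := 1)).2 zero_le_one
    have he' : ‖e‖ = 1 := by simpa using he
    refine (isPreconnected_sphere hrank 0 1).infinite_of_nontrivial ⟨e, he, -e, by simpa using he, ?_⟩
    intro h
    have h2 : (2 : ℝ) • e = 0 := by
      rw [two_smul]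
      nth_rewrite 2 [h]
      simp
    have h3 : e = 0 := (smul_eq_zero.1 h2).resolve_left two_ne_zero
    simp [h3] at he'
  -- `N` fixed points on the unit sphere, scaled by `‖x‖`, end up at distance at least `2ε` from
  -- each other: this gives `N` disjoint balls carrying the same mass as the ball around `x`.
  obtain ⟨t, ht, hcard⟩ := hinf.exists_subset_card_eq N
  have hev : ∀ᶠ R : ℝ in atTop, ∀ p ∈ t.offDiag, 2 * ε ≤ R * ‖p.1 - p.2‖ := by
    rw [Filter.eventually_all_finset]
    intro p hp
    have h1 : 0 < ‖p.1 - p.2‖ := norm_pos_iff.2 (sub_ne_zero.2 (Finset.mem_offDiag.1 hp).2.2)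
    exact (tendsto_id.atTop_mul_const h1).eventually_ge_atTop _
  obtain ⟨R, hR⟩ := eventually_atTop.1 hev
  refine ⟨max R 0, fun x hx u hum hu => ?_⟩
  have hx0 : 0 ≤ ‖x‖ := norm_nonneg x
  have hdisj : Set.PairwiseDisjoint (t : Set (Rn n)) fun a => Metric.ball (‖x‖ • a) ε := by
    intro a ha b hb hab
    apply Metric.ball_disjoint_ball
    rw [dist_eq_norm, ← smul_sub, norm_smul, norm_norm]
    have := hR ‖x‖ ((le_max_left _ _).trans hx) (a, b) (Finset.mem_offDiag.2 ⟨ha, hb, hab⟩)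
    simp only at this
    linarith
  have h1 := lintegral_biUnion_finset (μ := volume) hdisj (fun _ _ => Metric.isOpen_ball.measurableSet)
    (fun z => ‖u z‖ₑ ^ 2)
  have h2 : ∀ a ∈ t, ∫⁻ z in Metric.ball (‖x‖ • a) ε, ‖u z‖ₑ ^ 2
      = ∫⁻ z in Metric.ball x ε, ‖u z‖ₑ ^ 2 := by
    intro a ha
    have ha' : ‖a‖ = 1 := by simpa using ht ha
    exact hu.setLIntegral_ball_eq (by rw [norm_smul, norm_norm, ha', mul_one]) ε
  rw [Finset.sum_congr rfl h2, Finset.sum_const, hcard, nsmul_eq_mul] at h1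
  rw [← h1]
  exact setLIntegral_le_lintegral _ _

/-- Jensen's inequality for the bump measure, whose density is bounded and vanishes off the ball of
radius `rOut`. -/
theorem exists_enorm_moll_sq_le (φ : ContDiffBump (0 : Rn n)) : ∃ Φ : ℝ≥0,
    ∀ u : Rn n → ℝ, Measurable u → ∀ x,
      ‖moll φ u x‖ₑ ^ 2 ≤ Φ * ∫⁻ z in Metric.ball x φ.rOut, ‖u z‖ₑ ^ 2 := by
  obtain ⟨K, hK⟩ := (φ.hasCompactSupport_normed (μ := volume)).exists_bound_of_continuous
    φ.continuous_normed
  refine ⟨K.toNNReal, fun u hu x => ?_⟩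
  have hd : Measurable fun y : Rn n => ((φ.normed volume y).toNNReal : ℝ≥0∞) :=
    φ.continuous_normed.measurable.real_toNNReal.coe_nnreal_ennreal
  have hg : Measurable fun y : Rn n => ‖u y‖ₑ ^ 2 := hu.enorm.pow_const 2
  rw [moll_eq_integral]
  refine (sq_enorm_integral_le _ _).trans ?_
  rw [bumpMeasure, lintegral_withDensity_eq_lintegral_mul _ hd
    (g := fun y => ‖u (x - y)‖ₑ ^ 2) (hg.comp (measurable_const.sub measurable_id))]
  rw [← lintegral_sub_left_eq_self _ x, ← lintegral_const_mul _ hg,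
    ← lintegral_indicator Metric.isOpen_ball.measurableSet]
  apply lintegral_mono
  intro z
  simp only [Pi.mul_apply, sub_sub_cancel]
  by_cases hz : z ∈ Metric.ball x φ.rOut
  · rw [Set.indicator_of_mem hz]
    gcongr
    exact (le_abs_self _).trans (hK _)
  · rw [Set.indicator_of_notMem hz]
    have : x - z ∉ Function.support (φ.normed volume) := by
      rw [φ.support_normed_eq]
      simpa [dist_eq_norm, norm_sub_rev] using hz
    rw [Function.notMem_support] at this
    simp [this]

theorem norm_fst_le (w : sobolevH1 n) : ‖w.1.fst‖ ≤ ‖w‖ := by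
  have h := WithLp.prod_norm_sq_eq_of_L2 w.1
  exact (pow_le_pow_iff_left₀ (norm_nonneg _) (norm_nonneg w.1) two_ne_zero).1
    (by nlinarith [sq_nonneg ‖w.1.snd‖])

theorem norm_snd_le (w : sobolevH1 n) : ‖w.1.snd‖ ≤ ‖w‖ := by
  have h := WithLp.prod_norm_sq_eq_of_L2 w.1
  exact (pow_le_pow_iff_left₀ (norm_nonneg _) (norm_nonneg w.1) two_ne_zero).1
    (by nlinarith [sq_nonneg ‖w.1.fst‖])

theorem eLpNorm_eq_ofReal_norm {E : Type*} [NormedAddCommGroup E]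
    (u : Lp E 2 (volume : Measure (Rn n))) : eLpNorm (u : Rn n → E) 2 = ENNReal.ofReal ‖u‖ := by
  rw [Lp.norm_def, ENNReal.ofReal_toReal (Lp.eLpNorm_ne_top u)]

/-- The representing vector is `y ↦ φ(x - y)`. Consequently weak `L²` convergence forces pointwise
convergence of mollifications. -/
theorem exists_moll_eq_inner (φ : ContDiffBump (0 : Rn n)) (x : Rn n) : ∃ v : Lp ℝ 2 (volume : Measure (Rn n)), ∀ u : Lp ℝ 2 (volume : Measure (Rn n)),
      moll φ u x = inner ℝ u v := by
  have h : Continuous fun y => φ.normed volume (x - y) :=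
    φ.continuous_normed.comp (continuous_const.sub continuous_id)
  have hc : HasCompactSupport fun y => φ.normed volume (x - y) :=
    φ.hasCompactSupport_normed.comp_homeomorph (Homeomorph.subLeft x)
  have hm := h.memLp_of_hasCompactSupport (p := 2) (μ := volume) hc
  refine ⟨hm.toLp _, fun u => ?_⟩
  rw [moll_eq_integral_smul, L2.inner_def]
  apply integral_congr_ae
  filter_upwards [hm.coeFn_toLp] with y hy
  rw [hy]
  simp

end

/-! ### Compactness of the radial embedding -/

section

variable {n : ℕ}

/-- Pointwise splitting of `|u|^s` with respect to an approximation `a` of `u`. -/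
theorem rpow_le_split {u a T s r ρ : ℝ} (hT : 0 < T) (hρ : 0 < ρ) (hs : 2 < s) (hsr : s ≤ r)
    {P : Prop} [Decidable P] (hP : ¬ P → 2 * |a| ≤ ρ) :
    |u| ^ s ≤ 4 * T ^ (s - 2) * |u - a| ^ 2 + T ^ (s - r) * |u| ^ r
      + (if P then (2 * |a|) ^ s else 0) + ρ ^ (s - 2) * |u| ^ 2 := by
  have hu := abs_nonneg u
  have h1 : 0 ≤ T ^ (s - 2) := by positivity
  have h2 : 0 ≤ T ^ (s - r) * |u| ^ r := by positivity
  have h3 : 0 ≤ (if P then (2 * |a|) ^ s else 0) := by split_ifs <;> positivity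
  have h4 : 0 ≤ ρ ^ (s - 2) * |u| ^ 2 := by positivity
  have h5 : 0 ≤ 4 * T ^ (s - 2) * |u - a| ^ 2 := by positivity
  -- If `a` is a poor approximation of `u`, then `|u| ≤ 2|u - a|`, and interpolation at level `T`
  -- gives the first two terms. Otherwise `|u| < 2|a|`, leaving the third term where `P` holds;
  -- where it fails, `|u| ≤ ρ` and the fourth term suffices.
  by_cases h : 2 * |a| ≤ |u|
  · have h6 := rpow_le_add_of_pos hu hT hs.le hsr
    have h7 : |u| ≤ 2 * |u - a| := by
      have := abs_sub_abs_le_abs_sub u a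
      linarith
    have h8 : |u| ^ 2 ≤ 4 * |u - a| ^ 2 := by nlinarith
    nlinarith [mul_le_mul_of_nonneg_left h8 h1]
  · push Not at h
    by_cases hPP : P
    · rw [if_pos hPP]
      have := Real.rpow_le_rpow hu h.le (by linarith : 0 ≤ s)
      linarith
    · rcases hu.eq_or_lt with h0 | h0
      · have h6 : |u| ^ s = 0 := by rw [← h0, Real.zero_rpow (by linarith)]
        linarith
      · have h6 : |u| ^ s = |u| ^ (s - 2) * |u| ^ 2 := by
          rw [← Real.rpow_natCast, ← Real.rpow_add h0]
          norm_num
        have h7 : |u| ^ (s - 2) ≤ ρ ^ (s - 2) :=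
          Real.rpow_le_rpow hu (h.le.trans (hP hPP)) (by linarith)
        have h8 := mul_le_mul_of_nonneg_right h7 (sq_nonneg |u|)
        linarith

theorem lintegral_le_of_split {α : Type*} [MeasurableSpace α] {μ : Measure α}
    {F g₁ g₂ g₃ g₄ : α → ℝ≥0∞} {S : Set α} {c₁ c₂ c₄ : ℝ≥0∞} (hS : MeasurableSet S)
    (h₁ : Measurable g₁) (h₂ : Measurable g₂) (h₃ : Measurable g₃) (h₄ : Measurable g₄)
    (h : ∀ x, F x ≤ c₁ * g₁ x + c₂ * g₂ x + S.indicator g₃ x + c₄ * g₄ x) :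
    ∫⁻ x, F x ∂μ ≤ c₁ * ∫⁻ x, g₁ x ∂μ + c₂ * ∫⁻ x, g₂ x ∂μ + ∫⁻ x in S, g₃ x ∂μ
      + c₄ * ∫⁻ x, g₄ x ∂μ := by
  refine (lintegral_mono h).trans ?_
  rw [lintegral_add_right _ (h₄.const_mul _), lintegral_add_right _ (h₃.indicator hS),
    lintegral_add_right _ (h₂.const_mul _), lintegral_const_mul _ h₁, lintegral_const_mul _ h₂,
    lintegral_const_mul _ h₄, lintegral_indicator hS]

set_option maxHeartbeats 1000000 in
/-- Compactness of the embedding of radial `H¹` functions into `Lˢ` for subcritical `s > 2`. -/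
theorem tendsto_lintegral_rpow_of_radial (hn : 3 ≤ n) {s : ℝ} (hs : 2 < s)
    (hsr : s < 2 * (n : ℝ) / ((n : ℝ) - 2)) (w : ℕ → sobolevH1 n)
    (hrad : ∀ i, IsRadial (w i).1.fst) {M : ℝ} (hM : ∀ i, ‖w i‖ ≤ M)
    (hweak : ∀ v : Lp ℝ 2 (volume : Measure (Rn n)),
      Tendsto (fun i => inner ℝ (w i).1.fst v) atTop (𝓝 0)) :
    Tendsto (fun i => ∫⁻ x, ‖(w i).1.fst x‖ₑ ^ s) atTop (𝓝 0) := by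
  set r : ℝ := 2 * (n : ℝ) / ((n : ℝ) - 2) with hr
  have hM0 : 0 ≤ M := (norm_nonneg _).trans (hM 0)
  obtain ⟨C, hC⟩ := exists_sobolev_const hn
  set M' : ℝ≥0∞ := ENNReal.ofReal M with hM'
  have hu2 : ∀ i, eLpNorm ((w i).1.fst : Rn n → ℝ) 2 ≤ M' := fun i => by
    rw [eLpNorm_eq_ofReal_norm]
    exact ENNReal.ofReal_le_ofReal ((norm_fst_le _).trans (hM i))
  have hg2 : ∀ i, eLpNorm ((w i).1.snd : Rn n → Rn n) 2 ≤ M' := fun i => by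
    rw [eLpNorm_eq_ofReal_norm]
    exact ENNReal.ofReal_le_ofReal ((norm_snd_le _).trans (hM i))
  have hu2' : ∀ i, ∫⁻ x, ‖(w i).1.fst x‖ₑ ^ 2 ≤ M' ^ 2 := fun i => by
    rw [← eLpNorm_two_sq]
    exact pow_le_pow_left' (hu2 i) 2
  have hur : ∀ i, ∫⁻ x, ‖(w i).1.fst x‖ₑ ^ r ≤ (C * M') ^ r := fun i => by
    have h1 := eLpNorm_nnreal_pow_eq_lintegral (f := ((w i).1.fst : Rn n → ℝ)) (μ := volume)
      (p := r.toNNReal) (by simpa using by linarith)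
    rw [Real.coe_toNNReal _ (by linarith)] at h1
    rw [← h1]
    exact ENNReal.rpow_le_rpow ((hC (w i)).trans (mul_le_mul_right (hg2 i) _)) (by linarith)
  have hCM : (C * M') ^ r ≠ ∞ :=
    ENNReal.rpow_ne_top_of_nonneg (by linarith) (ENNReal.mul_ne_top ENNReal.coe_ne_top
      ENNReal.ofReal_ne_top)
  have hMtop : M' ^ 2 ≠ ∞ := ENNReal.pow_ne_top ENNReal.ofReal_ne_top
  rw [ENNReal.tendsto_nhds_zero]
  intro η hη
  -- One quarter for each term of `rpow_le_split`. The parameters `T`, `ε`, `ρ` and then `R` are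
  -- chosen uniformly in `i`; only the integral over the ball of radius `R` needs `i` to be large.
  have hη4 : 0 < η / 4 := ENNReal.div_pos hη.ne' (by norm_num)
  -- the cut-off level `T`
  obtain ⟨T, hT0, hT⟩ : ∃ T : ℝ, 0 < T ∧
      ENNReal.ofReal (T ^ (s - r)) * (C * M') ^ r ≤ η / 4 := by
    have h1 : Tendsto (fun T : ℝ => ENNReal.ofReal (T ^ (s - r)) * (C * M') ^ r) atTop (𝓝 0) := by
      have h2 := ENNReal.tendsto_ofReal (tendsto_rpow_neg_atTop (y := r - s) (by linarith))
      have h3 := ENNReal.Tendsto.mul_const h2 (Or.inr hCM)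
      simpa using h3
    obtain ⟨T, h2, h3⟩ := ((h1.eventually_le_const hη4).and (eventually_gt_atTop 0)).exists
    exact ⟨T, h3, h2⟩
  -- the mollification scale `ε`
  obtain ⟨ε, hε0, hε⟩ : ∃ ε : ℝ, 0 < ε ∧
      ENNReal.ofReal (4 * T ^ (s - 2)) * (ENNReal.ofReal ε * M') ^ 2 ≤ η / 4 := by
    have h1 : Tendsto (fun ε : ℝ => ENNReal.ofReal (4 * T ^ (s - 2)) * (ENNReal.ofReal ε * M') ^ 2)
        (𝓝[>] 0) (𝓝 0) := by
      have h2 : Tendsto (fun ε : ℝ => ENNReal.ofReal ε) (𝓝[>] 0) (𝓝 0) := by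
        have := ENNReal.tendsto_ofReal (tendsto_id (α := ℝ) (x := 𝓝 0))
        rw [ENNReal.ofReal_zero] at this
        exact this.mono_left nhdsWithin_le_nhds
      have h3 := ENNReal.Tendsto.pow (n := 2)
        (ENNReal.Tendsto.mul_const h2 (Or.inr (ENNReal.ofReal_ne_top (r := M))))
      have h4 := ENNReal.Tendsto.const_mul (a := ENNReal.ofReal (4 * T ^ (s - 2))) h3
        (Or.inr ENNReal.ofReal_ne_top)
      simpa using h4
    obtain ⟨ε, h2, h3⟩ := ((h1.eventually_le_const hη4).and self_mem_nhdsWithin).exists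
    exact ⟨ε, h3, h2⟩
  -- the level `ρ` outside a large ball
  obtain ⟨ρ, hρ0, hρ⟩ : ∃ ρ : ℝ, 0 < ρ ∧ ENNReal.ofReal (ρ ^ (s - 2)) * M' ^ 2 ≤ η / 4 := by
    have h1 : Tendsto (fun ρ : ℝ => ENNReal.ofReal (ρ ^ (s - 2)) * M' ^ 2) (𝓝[>] 0) (𝓝 0) := by
      have h2 : Tendsto (fun ρ : ℝ => ENNReal.ofReal (ρ ^ (s - 2))) (𝓝 0) (𝓝 0) := by
        have h3 := (Real.continuousAt_rpow_const 0 (s - 2) (Or.inr (by linarith))).tendsto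
        rw [Real.zero_rpow (by linarith)] at h3
        have := ENNReal.tendsto_ofReal h3
        rwa [ENNReal.ofReal_zero] at this
      have h3 := ENNReal.Tendsto.mul_const (h2.mono_left (nhdsWithin_le_nhds (s := Set.Ioi 0)))
        (Or.inr hMtop)
      rwa [zero_mul] at h3
    obtain ⟨ρ, h2, h3⟩ := ((h1.eventually_le_const hη4).and self_mem_nhdsWithin).exists
    exact ⟨ρ, h3, h2⟩
  let φ := bump n ε hε0
  have hφ : φ.rOut = ε := rfl
  let a : ℕ → Rn n → ℝ := fun i => moll φ (w i).1.fst
  have ham : ∀ i, Measurable (a i) := fun i =>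
    (contDiff_moll φ (locallyIntegrable_coe (w i).1.fst)).continuous.measurable
  have hum : ∀ i, Measurable ((w i).1.fst : Rn n → ℝ) := fun i =>
    (Lp.stronglyMeasurable _).measurable
  obtain ⟨Φ, hΦ⟩ := exists_enorm_moll_sq_le φ
  have ha_bd : ∀ i x, |a i x| ≤ Real.sqrt (Φ * M ^ 2) := by
    intro i x
    apply Real.abs_le_sqrt
    have h1 := hΦ _ (hum i) x
    have h2 : ‖a i x‖ₑ ^ 2 ≤ Φ * M' ^ 2 :=
      h1.trans (mul_le_mul_right ((setLIntegral_le_lintegral _ _).trans (hu2' i)) _)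
    rw [enorm_sq_eq, hM', ← ENNReal.ofReal_pow hM0, ← ENNReal.ofReal_coe_nnreal,
      ← ENNReal.ofReal_mul (by positivity), ENNReal.ofReal_le_ofReal_iff (by positivity)] at h2
    simpa using h2
  -- Outside radius `R` the mollification satisfies `N |a|² ≤ Φ M²`; this size of `N` turns that
  -- into `2|a| ≤ ρ`.
  obtain ⟨N, hN⟩ := exists_nat_gt (4 * (Φ * M ^ 2) / ρ ^ 2)
  obtain ⟨R, hR⟩ := exists_radius_mul_setLIntegral_ball_le (n := n) (by omega) ε N
  have ha_far : ∀ i x, R ≤ ‖x‖ → 2 * |a i x| ≤ ρ := by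
    intro i x hx
    have h1 := hΦ _ (hum i) x
    have h2 : N * ‖a i x‖ₑ ^ 2 ≤ Φ * M' ^ 2 := by
      calc (N : ℝ≥0∞) * ‖a i x‖ₑ ^ 2
          ≤ N * (Φ * ∫⁻ z in Metric.ball x ε, ‖(w i).1.fst z‖ₑ ^ 2) := mul_le_mul_right h1 _
        _ = Φ * (N * ∫⁻ z in Metric.ball x ε, ‖(w i).1.fst z‖ₑ ^ 2) := by ring
        _ ≤ Φ * M' ^ 2 := mul_le_mul_right ((hR x hx _ (hum i) (hrad i)).trans (hu2' i)) _
    rw [enorm_sq_eq, hM', ← ENNReal.ofReal_pow hM0, ← ENNReal.ofReal_coe_nnreal,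
      ← ENNReal.ofReal_natCast, ← ENNReal.ofReal_mul (by positivity),
      ← ENNReal.ofReal_mul (by positivity), ENNReal.ofReal_le_ofReal_iff (by positivity)] at h2
    rw [div_lt_iff₀ (by positivity)] at hN
    have h3 : (2 * |a i x|) ^ 2 ≤ ρ ^ 2 := by
      rw [Real.norm_eq_abs] at h2
      by_contra h4
      push Not at h4
      have h5 : (N : ℝ) * ρ ^ 2 ≤ N * (2 * |a i x|) ^ 2 :=
        mul_le_mul_of_nonneg_left h4.le (Nat.cast_nonneg N)
      nlinarith
    exact (pow_le_pow_iff_left₀ (by positivity) hρ0.le two_ne_zero).1 h3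
  -- The only place where weak convergence enters.
  have ha_lim : ∀ x, Tendsto (fun i => a i x) atTop (𝓝 0) := by
    intro x
    obtain ⟨v, hv⟩ := exists_moll_eq_inner φ x
    simp only [a, hv]
    exact hweak v
  have hloc : Tendsto (fun i => ∫⁻ x in Metric.ball (0 : Rn n) R,
      ENNReal.ofReal ((2 * |a i x|) ^ s)) atTop (𝓝 0) := by
    have h1 := tendsto_lintegral_of_dominated_convergence
      (μ := volume.restrict (Metric.ball (0 : Rn n) R)) (f := fun _ => 0)
      (F := fun i x => ENNReal.ofReal ((2 * |a i x|) ^ s))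
      (fun _ => ENNReal.ofReal ((2 * Real.sqrt (Φ * M ^ 2)) ^ s))
      (fun i => ENNReal.measurable_ofReal.comp (((ham i).abs.const_mul 2).pow_const s))
      (fun i => Eventually.of_forall fun x => ENNReal.ofReal_le_ofReal
        (Real.rpow_le_rpow (by positivity) (by linarith [ha_bd i x]) (by linarith)))
      (by
        rw [lintegral_const, Measure.restrict_apply_univ]
        exact ENNReal.mul_ne_top ENNReal.ofReal_ne_top measure_ball_lt_top.ne)
      (Eventually.of_forall fun x => by
        have h2 := ((ha_lim x).abs.const_mul 2).rpow_const (p := s) (Or.inr (by linarith))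
        rw [abs_zero, mul_zero, Real.zero_rpow (by linarith)] at h2
        have h3 := ENNReal.tendsto_ofReal h2
        rwa [ENNReal.ofReal_zero] at h3)
    simpa using h1
  filter_upwards [hloc.eventually_le_const hη4] with i hi
  classical
  have hpt : ∀ x, ‖(w i).1.fst x‖ₑ ^ s ≤
      ENNReal.ofReal (4 * T ^ (s - 2)) * ‖(w i).1.fst x - a i x‖ₑ ^ 2
      + ENNReal.ofReal (T ^ (s - r)) * ‖(w i).1.fst x‖ₑ ^ r
      + (Metric.ball (0 : Rn n) R).indicator (fun x => ENNReal.ofReal ((2 * |a i x|) ^ s)) x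
      + ENNReal.ofReal (ρ ^ (s - 2)) * ‖(w i).1.fst x‖ₑ ^ 2 := by
    intro x
    have h1 := rpow_le_split (u := (w i).1.fst x) (a := a i x) hT0 hρ0 hs hsr.le
      (P := x ∈ Metric.ball (0 : Rn n) R) (ρ := ρ) (fun h => ha_far i x (by simpa using h))
    rw [enorm_rpow_eq _ (by linarith), enorm_rpow_eq _ (by linarith), enorm_sq_eq, enorm_sq_eq,
      Set.indicator_apply, ← ENNReal.ofReal_mul (by positivity),
      ← ENNReal.ofReal_mul (by positivity), ← ENNReal.ofReal_mul (by positivity),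
      ← ENNReal.ofReal_zero, ← apply_ite ENNReal.ofReal, ← ENNReal.ofReal_add (by positivity)
        (by positivity), ← ENNReal.ofReal_add (by positivity) (by split_ifs <;> positivity),
        ← ENNReal.ofReal_add (by split_ifs <;> positivity) (by positivity)]
    apply ENNReal.ofReal_le_ofReal
    simpa using h1
  have hm1 : Measurable fun x => ‖(w i).1.fst x - a i x‖ₑ ^ 2 :=
    ((hum i).sub (ham i)).enorm.pow_const 2
  have hm2 : Measurable fun x => ‖(w i).1.fst x‖ₑ ^ r := (hum i).enorm.pow_const r
  have hm3 : Measurable fun x => ‖(w i).1.fst x‖ₑ ^ 2 := (hum i).enorm.pow_const 2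
  have e1 : ∫⁻ x, ‖(w i).1.fst x - a i x‖ₑ ^ 2 ≤ (ENNReal.ofReal ε * M') ^ 2 := by
    rw [← eLpNorm_two_sq volume (fun x => (w i).1.fst x - a i x)]
    exact pow_le_pow_left' ((eLpNorm_sub_moll_le φ (w i)).trans (mul_le_mul_right (hg2 i) _)) 2
  have hm4 : Measurable fun x => ENNReal.ofReal ((2 * |a i x|) ^ s) :=
    ENNReal.measurable_ofReal.comp (((ham i).abs.const_mul 2).pow_const s)
  refine (lintegral_le_of_split (μ := volume) Metric.isOpen_ball.measurableSet hm1 hm2 hm4 hm3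
    hpt).trans ?_
  calc _ ≤ η / 4 + η / 4 + η / 4 + η / 4 := by
        refine add_le_add (add_le_add (add_le_add ?_ ?_) hi) ?_
        · exact (mul_le_mul_right e1 _).trans hε
        · exact (mul_le_mul_right (hur i) _).trans hT
        · exact (mul_le_mul_right (hu2' i) _).trans hρ
    _ = η := by
        have h := ENNReal.div_mul_cancel (a := 4) (b := η) (by norm_num) (by norm_num)
        calc _ = η / 4 * 4 := by ring
          _ = η := h

end

/-! ### Vector-valued Sobolev embeddings and Hölder estimates -/

section

variable {n k : ℕ}

/-- The critical Sobolev exponent `2n / (n - 2)`. -/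
def critExp (n : ℕ) : ℝ := 2 * (n : ℝ) / ((n : ℝ) - 2)

theorem two_lt_critExp (hn : 3 ≤ n) : 2 < critExp n := by
  have hn' : (3 : ℝ) ≤ n := by exact_mod_cast hn
  rw [critExp, lt_div_iff₀ (by linarith)]
  linarith

theorem measurable_comp (u : H n k) (j : Fin k) : Measurable (comp u j) :=
  (Lp.stronglyMeasurable _).measurable

theorem measurable_val (u : H n k) : Measurable (val u) :=
  (PiLp.continuous_toLp 2 _).measurable.comp (measurable_pi_lambda _ fun j => measurable_comp u j)

theorem val_add (u v : H n k) : ∀ᵐ x, val (u + v) x = val u x + val v x := by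
  have h : ∀ᵐ x, ∀ j, comp (u + v) j x = comp u j x + comp v j x :=
    ae_all_iff.2 fun j => Lp.coeFn_add (u j).1.fst (v j).1.fst
  filter_upwards [h] with x hx
  ext j
  exact hx j

theorem val_smul (c : ℝ) (u : H n k) : ∀ᵐ x, val (c • u) x = c • val u x := by
  have h : ∀ᵐ x, ∀ j, comp (c • u) j x = c * comp u j x :=
    ae_all_iff.2 fun j => Lp.coeFn_smul c (u j).1.fst
  filter_upwards [h] with x hx
  ext j
  exact hx j

theorem eLpNorm_val_le (u : H n k) {p : ℝ≥0∞} (hp : 1 ≤ p) :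
    eLpNorm (val u) p ≤ ∑ j, eLpNorm (comp u j) p := by
  have h1 : ∀ x, ‖val u x‖ ≤ ∑ j, ‖comp u j x‖ := by
    intro x
    have : val u x = ∑ j, EuclideanSpace.single j (comp u j x) := by
      ext i
      simp [val, Finset.sum_apply, Pi.single_apply]
    rw [this]
    refine (norm_sum_le _ _).trans (le_of_eq ?_)
    simp
  have h2 : eLpNorm (val u) p ≤ eLpNorm (∑ j, fun x => ‖comp u j x‖) p (volume : Measure (Rn n)) :=
    eLpNorm_mono_real (fun x => by simpa using h1 x)
  refine h2.trans ((eLpNorm_sum_le (fun j _ =>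
    (measurable_comp u j).norm.aestronglyMeasurable) hp).trans (le_of_eq ?_))
  simp_rw [eLpNorm_norm]

theorem norm_comp_le (u : H n k) (j : Fin k) : ‖u j‖ ≤ ‖u‖ := PiLp.norm_apply_le u j

theorem memLp_val_two (u : H n k) : MemLp (val u) 2 := by
  refine ⟨(measurable_val u).aestronglyMeasurable, (eLpNorm_val_le u one_le_two).trans_lt ?_⟩
  exact ENNReal.sum_lt_top.2 fun j _ => Lp.eLpNorm_lt_top _

theorem integral_sq_comp (u : H n k) (j : Fin k) : ∫ x, comp u j x ^ 2 = ‖(u j).1.fst‖ ^ 2 := by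
  rw [← real_inner_self_eq_norm_sq, L2.inner_def]
  congr 1 with x
  simp [comp, sq]

theorem integral_sq_gradComp (u : H n k) (j : Fin k) :
    ∫ x, ‖gradComp u j x‖ ^ 2 = ‖(u j).1.snd‖ ^ 2 := by
  rw [← real_inner_self_eq_norm_sq, L2.inner_def]
  congr 1 with x
  simp [gradComp]

theorem integrable_sq_comp (u : H n k) (j : Fin k) : Integrable fun x => comp u j x ^ 2 :=
  (Lp.memLp (u j).1.fst).integrable_sq

theorem integral_sq_val (u : H n k) : ∫ x, ‖val u x‖ ^ 2 = ∑ j, ‖(u j).1.fst‖ ^ 2 := by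
  simp_rw [← integral_sq_comp]
  rw [← integral_finsetSum _ fun j _ => integrable_sq_comp u j]
  congr 1 with x
  simp [EuclideanSpace.norm_sq_eq, val]

theorem norm_sq_eq (u : H n k) : ‖u‖ ^ 2 = ∑ j, (‖(u j).1.fst‖ ^ 2 + ‖(u j).1.snd‖ ^ 2) := by
  rw [PiLp.norm_sq_eq_of_L2]
  exact Finset.sum_congr rfl fun j _ => WithLp.prod_norm_sq_eq_of_L2 (u j).1

theorem integral_norm_rpow_eq {V : Type*} [NormedAddCommGroup V] {f : Rn n → V} {s : ℝ}
    (hs : 0 < s) (hf : MemLp f (ENNReal.ofReal s)) :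
    ∫ x, ‖f x‖ ^ s = (eLpNorm f (ENNReal.ofReal s)).toReal ^ s := by
  have h0 : 0 ≤ ∫ x, ‖f x‖ ^ s := integral_nonneg fun x => by positivity
  rw [hf.eLpNorm_eq_integral_rpow_norm (by simpa using hs) ENNReal.ofReal_ne_top,
    ENNReal.toReal_ofReal hs.le, ENNReal.toReal_ofReal (by positivity), ← Real.rpow_mul h0,
    inv_mul_cancel₀ hs.ne', Real.rpow_one]

theorem exists_eLpNorm_val_critExp_le (hn : 3 ≤ n) (k : ℕ) : ∃ C : ℝ, 0 ≤ C ∧ ∀ u : H n k,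
    eLpNorm (val u) (ENNReal.ofReal (critExp n)) ≤ ENNReal.ofReal (C * ∑ j, ‖(u j).1.snd‖) := by
  obtain ⟨C, hC⟩ := exists_sobolev_const hn
  refine ⟨C, C.2, fun u => ?_⟩
  have h1 : 1 ≤ ENNReal.ofReal (critExp n) := by
    rw [← ENNReal.ofReal_one]
    exact ENNReal.ofReal_le_ofReal (by linarith [two_lt_critExp hn])
  refine (eLpNorm_val_le u h1).trans ?_
  rw [Finset.mul_sum, ENNReal.ofReal_sum_of_nonneg (fun j _ => by positivity)]
  refine Finset.sum_le_sum fun j _ => (hC (u j)).trans (le_of_eq ?_)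
  rw [eLpNorm_eq_ofReal_norm, ENNReal.ofReal_mul (p := (C : ℝ)) C.2, ENNReal.ofReal_coe_nnreal]

theorem memLp_val_critExp (hn : 3 ≤ n) (u : H n k) :
    MemLp (val u) (ENNReal.ofReal (critExp n)) := by
  obtain ⟨C, _, hC⟩ := exists_eLpNorm_val_critExp_le hn k
  exact ⟨(measurable_val u).aestronglyMeasurable, (hC u).trans_lt ENNReal.ofReal_lt_top⟩

theorem integrable_rpow_val_critExp (hn : 3 ≤ n) (u : H n k) :
    Integrable fun x => ‖val u x‖ ^ critExp n := by
  have h := (memLp_val_critExp hn u).integrable_norm_rpow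
    (by simpa using by linarith [two_lt_critExp hn]) ENNReal.ofReal_ne_top
  rwa [ENNReal.toReal_ofReal (by linarith [two_lt_critExp hn])] at h

theorem integrable_sq_val (u : H n k) : Integrable fun x => ‖val u x‖ ^ 2 :=
  (memLp_val_two u).norm.integrable_sq

theorem integrable_rpow_val (hn : 3 ≤ n) {s : ℝ} (hs : 2 ≤ s) (hsr : s ≤ critExp n) (u : H n k) :
    Integrable fun x => ‖val u x‖ ^ s := by
  refine ((integrable_sq_val u).add (integrable_rpow_val_critExp hn u)).mono'
    ((measurable_val u).norm.pow_const s).aestronglyMeasurable (Eventually.of_forall fun x => ?_)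
  have h := rpow_le_add_of_pos (norm_nonneg (val u x)) one_pos hs hsr
  rw [Real.one_rpow, Real.one_rpow, one_mul, one_mul] at h
  rw [Real.norm_of_nonneg (by positivity)]
  exact h

theorem memLp_val (hn : 3 ≤ n) {s : ℝ} (hs : 2 ≤ s) (hsr : s ≤ critExp n) (u : H n k) :
    MemLp (val u) (ENNReal.ofReal s) := by
  rw [← integrable_norm_rpow_iff (measurable_val u).aestronglyMeasurable
    (by simpa using by linarith) ENNReal.ofReal_ne_top, ENNReal.toReal_ofReal (by linarith)]
  exact integrable_rpow_val hn hs hsr u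

/-- The level `T` stays free: taking it equal to `‖u‖` gives the homogeneous embedding, taking it
small makes the `L²` part absorbable in `exists_potential_le`. -/
theorem integral_rpow_val_le (hn : 3 ≤ n) {s : ℝ} (hs : 2 ≤ s) (hsr : s ≤ critExp n) (u : H n k)
    {T : ℝ} (hT : 0 < T) :
    ∫ x, ‖val u x‖ ^ s ≤ T ^ (s - 2) * (∫ x, ‖val u x‖ ^ 2)
      + T ^ (s - critExp n) * ∫ x, ‖val u x‖ ^ critExp n := by
  have h2 := (integrable_sq_val u).const_mul (T ^ (s - 2))
  have h3 := (integrable_rpow_val_critExp hn u).const_mul (T ^ (s - critExp n))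
  rw [← integral_const_mul, ← integral_const_mul, ← integral_add h2 h3]
  exact integral_mono (integrable_rpow_val hn hs hsr u) (h2.add h3)
    fun x => rpow_le_add_of_pos (norm_nonneg _) hT hs hsr

theorem exists_integral_critExp_le (hn : 3 ≤ n) (k : ℕ) : ∃ C : ℝ, 0 ≤ C ∧ ∀ u : H n k,
    ∫ x, ‖val u x‖ ^ critExp n ≤ (C * ∑ j, ‖(u j).1.snd‖) ^ critExp n := by
  obtain ⟨C, hC0, hC⟩ := exists_eLpNorm_val_critExp_le hn k
  have h2 := two_lt_critExp hn
  refine ⟨C, hC0, fun u => ?_⟩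
  rw [integral_norm_rpow_eq (by linarith) (memLp_val_critExp hn u)]
  refine Real.rpow_le_rpow ENNReal.toReal_nonneg ?_ (by linarith)
  exact ENNReal.toReal_le_of_le_ofReal
    (mul_nonneg hC0 (Finset.sum_nonneg fun j _ => norm_nonneg _)) (hC u)

/-- The Sobolev embedding of `H` into `Lˢ`. -/
theorem exists_integral_rpow_val_le (hn : 3 ≤ n) (k : ℕ) {s : ℝ} (hs : 2 ≤ s)
    (hsr : s ≤ critExp n) : ∃ C : ℝ, 0 ≤ C ∧ ∀ u : H n k, ∫ x, ‖val u x‖ ^ s ≤ C * ‖u‖ ^ s := by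
  obtain ⟨C, hC0, hC⟩ := exists_integral_critExp_le hn k
  have h2r := two_lt_critExp hn
  refine ⟨1 + (C * k) ^ critExp n, by positivity, fun u => ?_⟩
  have h2 : ∫ x, ‖val u x‖ ^ 2 ≤ ‖u‖ ^ 2 := by
    rw [integral_sq_val, norm_sq_eq]
    exact Finset.sum_le_sum fun j _ => by nlinarith [sq_nonneg ‖(u j).1.snd‖]
  have h3 : ∫ x, ‖val u x‖ ^ critExp n ≤ (C * k) ^ critExp n * ‖u‖ ^ critExp n := by
    refine (hC u).trans ?_
    rw [← Real.mul_rpow (by positivity) (norm_nonneg _)]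
    refine Real.rpow_le_rpow (mul_nonneg hC0 (Finset.sum_nonneg fun j _ => norm_nonneg _)) ?_
      (by linarith)
    rw [mul_assoc]
    refine mul_le_mul_of_nonneg_left ?_ hC0
    calc ∑ j, ‖(u j).1.snd‖ ≤ ∑ _j : Fin k, ‖u‖ :=
          Finset.sum_le_sum fun j _ => (norm_snd_le _).trans (norm_comp_le u j)
      _ = k * ‖u‖ := by simp
  -- For `u ≠ 0`, the level `T = ‖u‖` makes both interpolation terms homogeneous of degree `s`; for
  -- `‖u‖ = 0` any positive level works.
  rcases (norm_nonneg u).eq_or_lt with h0 | h0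
  · have h4 := integral_rpow_val_le hn hs hsr u one_pos
    rw [← h0] at h2 h3 ⊢
    rw [Real.zero_rpow (by linarith), mul_zero] at h3 ⊢
    rw [Real.one_rpow, Real.one_rpow] at h4
    nlinarith
  · have h4 := integral_rpow_val_le hn hs hsr u h0
    have e1 : ‖u‖ ^ (s - 2) * ‖u‖ ^ 2 = ‖u‖ ^ s := by
      rw [← Real.rpow_natCast, ← Real.rpow_add h0]
      norm_num
    have e2 : ‖u‖ ^ (s - critExp n) * ‖u‖ ^ critExp n = ‖u‖ ^ s := by
      rw [← Real.rpow_add h0]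
      norm_num
    calc _ ≤ _ := h4
      _ ≤ ‖u‖ ^ (s - 2) * ‖u‖ ^ 2
          + ‖u‖ ^ (s - critExp n) * ((C * k) ^ critExp n * ‖u‖ ^ critExp n) := by gcongr
      _ = _ := by
        rw [e1, add_mul, one_mul, ← e2]
        ring

theorem holderConjugate_div {s : ℝ} (hs : 1 < s) : (s / (s - 1)).HolderConjugate s :=
  (Real.HolderConjugate.conjExponent hs).symm

/-- Hölder's inequality for a nonnegative function dominated by the `(s - 1)`-th power of the norm
of an `Lˢ` function. -/
theorem integral_mul_norm_le {V W : Type*} [NormedAddCommGroup V] [NormedAddCommGroup W] {s : ℝ}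
    (hs : 1 < s) {f : Rn n → V} {g : Rn n → W} {m : Rn n → ℝ} {K : ℝ}
    (hf : MemLp f (ENNReal.ofReal s)) (hg : MemLp g (ENNReal.ofReal s))
    (hm : AEStronglyMeasurable m) (hm0 : ∀ x, 0 ≤ m x) (hmK : ∀ x, m x ≤ K * ‖f x‖ ^ (s - 1)) :
    Integrable (fun x => m x * ‖g x‖) ∧ Integrable (fun x => m x ^ (s / (s - 1))) ∧
    ∫ x, m x * ‖g x‖ ≤ (∫ x, m x ^ (s / (s - 1))) ^ ((s - 1) / s) * (∫ x, ‖g x‖ ^ s) ^ (1 / s) := by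
  have hs1 : 0 < s - 1 := by linarith
  have hc := holderConjugate_div hs
  have hq : 0 < s / (s - 1) := by positivity
  have hfi : Integrable fun x => ‖f x‖ ^ s := by
    have h := hf.integrable_norm_rpow (by simpa using by linarith) ENNReal.ofReal_ne_top
    rwa [ENNReal.toReal_ofReal (by linarith)] at h
  have hmi : Integrable fun x => m x ^ (s / (s - 1)) := by
    refine (hfi.const_mul (|K| ^ (s / (s - 1)))).mono'
      (hm.aemeasurable.pow_const _).aestronglyMeasurable (Eventually.of_forall fun x => ?_)
    rw [Real.norm_of_nonneg (Real.rpow_nonneg (hm0 x) _)]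
    calc m x ^ (s / (s - 1)) ≤ (|K| * ‖f x‖ ^ (s - 1)) ^ (s / (s - 1)) :=
          Real.rpow_le_rpow (hm0 x) ((hmK x).trans
            (mul_le_mul_of_nonneg_right (le_abs_self K) (by positivity))) hq.le
      _ = |K| ^ (s / (s - 1)) * ‖f x‖ ^ s := by
          rw [Real.mul_rpow (abs_nonneg _) (by positivity), ← Real.rpow_mul (norm_nonneg _),
            mul_div_cancel₀ _ hs1.ne']
  have hmL : MemLp m (ENNReal.ofReal (s / (s - 1))) := by
    rw [← integrable_norm_rpow_iff hm (by simpa using hq) ENNReal.ofReal_ne_top,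
      ENNReal.toReal_ofReal hq.le]
    refine hmi.congr (Eventually.of_forall fun x => ?_)
    simp only [Real.norm_of_nonneg (hm0 x)]
  refine ⟨?_, hmi, ?_⟩
  · have : ENNReal.HolderTriple (ENNReal.ofReal (s / (s - 1))) (ENNReal.ofReal s) 1 :=
      hc.ennrealOfReal
    exact hmL.integrable_mul hg.norm
  · have h := integral_mul_le_Lp_mul_Lq_of_nonneg hc (Eventually.of_forall hm0)
      (Eventually.of_forall fun x => norm_nonneg (g x)) hmL hg.norm
    rwa [one_div_div] at h

theorem integral_rpow_mul_norm_le {V W : Type*} [NormedAddCommGroup V] [NormedAddCommGroup W]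
    {s : ℝ} (hs : 1 < s) {f : Rn n → V} {g : Rn n → W}
    (hf : MemLp f (ENNReal.ofReal s)) (hg : MemLp g (ENNReal.ofReal s)) :
    Integrable (fun x => ‖f x‖ ^ (s - 1) * ‖g x‖) ∧
    ∫ x, ‖f x‖ ^ (s - 1) * ‖g x‖ ≤
      (∫ x, ‖f x‖ ^ s) ^ ((s - 1) / s) * (∫ x, ‖g x‖ ^ s) ^ (1 / s) := by
  have h := integral_mul_norm_le hs (m := fun x => ‖f x‖ ^ (s - 1)) (K := 1) hf hg
    (hf.1.norm.aemeasurable.pow_const _).aestronglyMeasurable (fun x => by positivity)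
    (fun x => by rw [one_mul])
  have e : ∀ x, (‖f x‖ ^ (s - 1)) ^ (s / (s - 1)) = ‖f x‖ ^ s := fun x => by
    rw [← Real.rpow_mul (norm_nonneg _), mul_div_cancel₀ _ (by linarith)]
  simp_rw [e] at h
  exact ⟨h.1, h.2.2⟩

/-- Bounded radial sequences which converge weakly to zero tend to zero in `Lˢ`. -/
theorem tendsto_integral_rpow_val (hn : 3 ≤ n) {s : ℝ} (hs : 2 < s) (hsr : s < critExp n)
    {w : ℕ → H n k} (hrad : ∀ i, w i ∈ radial n k) {M : ℝ} (hM : ∀ i, ‖w i‖ ≤ M)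
    (hweak : ∀ j, ∀ v : Lp ℝ 2 (volume : Measure (Rn n)),
      Tendsto (fun i => inner ℝ (w i j).1.fst v) atTop (𝓝 0)) :
    Tendsto (fun i => ∫ x, ‖val (w i) x‖ ^ s) atTop (𝓝 0) := by
  have h1 : ∀ j, Tendsto (fun i => eLpNorm (comp (w i) j) (ENNReal.ofReal s)) atTop (𝓝 0) := by
    intro j
    have h2 := tendsto_lintegral_rpow_of_radial hn hs hsr (fun i => w i j) (fun i => hrad i j)
      (fun i => (norm_comp_le (w i) j).trans (hM i)) (hweak j)
    have h3 : ∀ i, eLpNorm (comp (w i) j) (ENNReal.ofReal s)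
        = (∫⁻ x, ‖(w i j).1.fst x‖ₑ ^ s) ^ (1 / s) := fun i => by
      rw [eLpNorm_eq_lintegral_rpow_enorm_toReal (by simpa using by linarith)
        ENNReal.ofReal_ne_top, ENNReal.toReal_ofReal (by linarith)]
      rfl
    simp_rw [h3]
    have h4 := h2.ennrpow_const (1 / s)
    rwa [ENNReal.zero_rpow_of_pos (by positivity)] at h4
  have h5 : Tendsto (fun i => eLpNorm (val (w i)) (ENNReal.ofReal s)) atTop (𝓝 0) := by
    have h6 : Tendsto (fun i => ∑ j, eLpNorm (comp (w i) j) (ENNReal.ofReal s)) atTop (𝓝 0) := by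
      simpa using tendsto_finsetSum Finset.univ fun j _ => h1 j
    refine tendsto_of_tendsto_of_tendsto_of_le_of_le tendsto_const_nhds h6 (fun _ => zero_le)
      fun i => eLpNorm_val_le _ ?_
    rw [← ENNReal.ofReal_one]
    exact ENNReal.ofReal_le_ofReal (by linarith)
  have h7 := ((ENNReal.tendsto_toReal ENNReal.zero_ne_top).comp h5).rpow_const (p := s)
    (Or.inr (by linarith))
  rw [ENNReal.toReal_zero, Real.zero_rpow (by linarith)] at h7
  refine h7.congr fun i => ?_
  rw [integral_norm_rpow_eq (by linarith) (memLp_val hn hs.le hsr.le (w i))]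
  rfl

end

/-! ### Growth estimates for the potential -/

section

variable {n k : ℕ}

theorem add_rpow_le {a b t : ℝ} (ha : 0 ≤ a) (hb : 0 ≤ b) (ht : 0 ≤ t) :
    (a + b) ^ t ≤ 2 ^ t * (a ^ t + b ^ t) := by
  wlog hab : a ≤ b generalizing a b
  · rw [add_comm a b, add_comm (a ^ t)]
    exact this hb ha (le_of_not_ge hab)
  calc (a + b) ^ t ≤ (2 * b) ^ t := Real.rpow_le_rpow (by positivity) (by linarith) ht
    _ = 2 ^ t * b ^ t := Real.mul_rpow (by norm_num) hb
    _ ≤ _ := mul_le_mul_of_nonneg_left (by linarith [Real.rpow_nonneg ha t]) (by positivity)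

section Potential

variable {V : Type*} [NormedAddCommGroup V] [NormedSpace ℝ V] {G : V → ℝ} {c p q : ℝ}

/-- Mean value inequality on the closed ball of radius `‖z‖ + ‖y‖`, which contains both endpoints.
-/
theorem abs_sub_le_of_growth (hG : ContDiff ℝ 1 G) (hc : 0 ≤ c) (hp : 1 ≤ p) (hq : 1 ≤ q)
    (hDG : ∀ z, ‖fderiv ℝ G z‖ ≤ c * (‖z‖ ^ (p - 1) + ‖z‖ ^ (q - 1))) (z y : V) :
    |G (z + y) - G z| ≤ c * ((‖z‖ + ‖y‖) ^ (p - 1) + (‖z‖ + ‖y‖) ^ (q - 1)) * ‖y‖ := by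
  have h := (convex_closedBall (0 : V) (‖z‖ + ‖y‖)).norm_image_sub_le_of_norm_fderiv_le
    (f := G) (𝕜 := ℝ) (C := c * ((‖z‖ + ‖y‖) ^ (p - 1) + (‖z‖ + ‖y‖) ^ (q - 1)))
    (fun x _ => hG.differentiable (by simp) x) (fun x hx => by
      have hx' : ‖x‖ ≤ ‖z‖ + ‖y‖ := by simpa using hx
      refine (hDG x).trans (mul_le_mul_of_nonneg_left ?_ hc)
      exact add_le_add (Real.rpow_le_rpow (norm_nonneg _) hx' (by linarith))
        (Real.rpow_le_rpow (norm_nonneg _) hx' (by linarith)))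
    (x := z) (y := z + y) (by simp) (by simpa using norm_add_le z y)
  simpa using h

theorem abs_le_of_growth (hG : ContDiff ℝ 1 G) (hG0 : G 0 = 0) (hc : 0 ≤ c) (hp : 1 < p)
    (hq : 1 < q) (hDG : ∀ z, ‖fderiv ℝ G z‖ ≤ c * (‖z‖ ^ (p - 1) + ‖z‖ ^ (q - 1))) (z : V) :
    |G z| ≤ c * (‖z‖ ^ p + ‖z‖ ^ q) := by
  have h := abs_sub_le_of_growth hG hc hp.le hq.le hDG 0 z
  have e : ∀ t : ℝ, 1 < t → ‖z‖ ^ t = ‖z‖ ^ (t - 1) * ‖z‖ := fun t ht => by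
    rw [← Real.rpow_add_one' (norm_nonneg _) (by linarith), sub_add_cancel]
  rw [zero_add, hG0, sub_zero, norm_zero, zero_add] at h
  rw [e p hp, e q hq]
  linarith

/-- The remainder quotient of the first order expansion of `G`. -/
def remainderQuot (G : V → ℝ) (z y : V) : ℝ := |G (z + y) - G z - fderiv ℝ G z y| / ‖y‖

theorem remainderQuot_nonneg (z y : V) : 0 ≤ remainderQuot G z y := by
  unfold remainderQuot
  positivity

theorem remainderQuot_mul_norm (z y : V) :
    remainderQuot G z y * ‖y‖ = |G (z + y) - G z - fderiv ℝ G z y| := by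
  unfold remainderQuot
  by_cases hy : y = 0
  · simp [hy]
  · rw [div_mul_cancel₀ _ (norm_ne_zero_iff.2 hy)]

theorem tendsto_remainderQuot (hG : ContDiff ℝ 1 G) (z : V) {ι : Type*} {l : Filter ι} {y : ι → V}
    (hy : Tendsto y l (𝓝 0)) : Tendsto (fun i => remainderQuot G z (y i)) l (𝓝 0) := by
  have h1 := hasFDerivAt_iff_tendsto.1 ((hG.differentiable (by simp) z).hasFDerivAt)
  have h2 : Tendsto (fun i => z + y i) l (𝓝 z) := by simpa using hy.const_add z
  refine (h1.comp h2).congr fun i => ?_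
  simp only [Function.comp_apply, add_sub_cancel_left, remainderQuot, Real.norm_eq_abs]
  rw [inv_mul_eq_div]

/-- The factor `2 ^ (q - 1)` comes from splitting powers of `‖z‖ + ‖y‖` and dominates `2 ^ (p - 1)`;
the added `1` pays for the linear term, so both powers share one constant. -/
theorem remainderQuot_le (hG : ContDiff ℝ 1 G) (hc : 0 ≤ c) (hp : 1 ≤ p) (hpq : p ≤ q)
    (hDG : ∀ z, ‖fderiv ℝ G z‖ ≤ c * (‖z‖ ^ (p - 1) + ‖z‖ ^ (q - 1))) (z y : V) :
    remainderQuot G z y ≤ c * (2 ^ (q - 1) + 1) * (‖z‖ ^ (p - 1) + ‖y‖ ^ (p - 1))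
      + c * (2 ^ (q - 1) + 1) * (‖z‖ ^ (q - 1) + ‖y‖ ^ (q - 1)) := by
  have hz := norm_nonneg z
  have hy := norm_nonneg y
  have h1 := abs_sub_le_of_growth hG hc hp (hp.trans hpq) hDG z y
  have h2 : |fderiv ℝ G z y| ≤ c * (‖z‖ ^ (p - 1) + ‖z‖ ^ (q - 1)) * ‖y‖ :=
    ((fderiv ℝ G z).le_opNorm y).trans (mul_le_mul_of_nonneg_right (hDG z) hy)
  have h3 : (2 : ℝ) ^ (p - 1) ≤ 2 ^ (q - 1) :=
    Real.rpow_le_rpow_of_exponent_le one_le_two (by linarith)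
  have hzp := Real.rpow_nonneg hz (p - 1)
  have hyp := Real.rpow_nonneg hy (p - 1)
  have hzq := Real.rpow_nonneg hz (q - 1)
  have hyq := Real.rpow_nonneg hy (q - 1)
  have h4 : (‖z‖ + ‖y‖) ^ (p - 1) ≤ 2 ^ (q - 1) * (‖z‖ ^ (p - 1) + ‖y‖ ^ (p - 1)) :=
    (add_rpow_le hz hy (by linarith)).trans (mul_le_mul_of_nonneg_right h3 (by linarith))
  have h5 : (‖z‖ + ‖y‖) ^ (q - 1) ≤ 2 ^ (q - 1) * (‖z‖ ^ (q - 1) + ‖y‖ ^ (q - 1)) :=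
    add_rpow_le hz hy (by linarith)
  have hB : 0 ≤ c * (2 ^ (q - 1) + 1) * (‖z‖ ^ (p - 1) + ‖y‖ ^ (p - 1))
      + c * (2 ^ (q - 1) + 1) * (‖z‖ ^ (q - 1) + ‖y‖ ^ (q - 1)) := by positivity
  rw [remainderQuot]
  refine div_le_of_le_mul₀ hy hB ?_
  refine (abs_sub _ _).trans ((add_le_add h1 h2).trans ?_)
  rw [← add_mul]
  refine mul_le_mul_of_nonneg_right ?_ hy
  have h6 := mul_le_mul_of_nonneg_left (add_le_add h4 h5) hc
  have h7 := mul_nonneg hc hyp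
  have h8 := mul_nonneg hc hyq
  linarith

/-- Splitting of the remainder into parts which are controlled by `z` and by `y`. -/
theorem abs_remainder_le {K : ℝ} {z y : V} (hK : 0 ≤ K)
    (h : remainderQuot G z y ≤ K * (‖z‖ ^ (p - 1) + ‖y‖ ^ (p - 1))
      + K * (‖z‖ ^ (q - 1) + ‖y‖ ^ (q - 1))) (hp : 1 < p) (hq : 1 < q) :
    |G (z + y) - G z - fderiv ℝ G z y| ≤
      (min (remainderQuot G z y) (K * ‖z‖ ^ (p - 1)) * ‖y‖ + K * ‖y‖ ^ p)
      + (min (remainderQuot G z y) (K * ‖z‖ ^ (q - 1)) * ‖y‖ + K * ‖y‖ ^ q) := by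
  have e : ∀ t : ℝ, 1 < t → ‖y‖ ^ t = ‖y‖ ^ (t - 1) * ‖y‖ := fun t ht => by
    rw [← Real.rpow_add_one' (norm_nonneg _) (by linarith), sub_add_cancel]
  rw [← remainderQuot_mul_norm, e p hp, e q hq]
  have h0 := remainderQuot_nonneg (G := G) z y
  have ha : 0 ≤ K * ‖z‖ ^ (p - 1) := by positivity
  have hb : 0 ≤ K * ‖y‖ ^ (p - 1) := by positivity
  have hc : 0 ≤ K * ‖z‖ ^ (q - 1) := by positivity
  have hd : 0 ≤ K * ‖y‖ ^ (q - 1) := by positivity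
  -- If one of the minima is the quotient itself, nothing is left to show; otherwise the right-hand
  -- side is exactly the bound in `h`.
  have key : remainderQuot G z y ≤ (min (remainderQuot G z y) (K * ‖z‖ ^ (p - 1))
      + K * ‖y‖ ^ (p - 1)) + (min (remainderQuot G z y) (K * ‖z‖ ^ (q - 1))
      + K * ‖y‖ ^ (q - 1)) := by
    rcases min_cases (remainderQuot G z y) (K * ‖z‖ ^ (p - 1)) with ⟨h1, h2⟩ | ⟨h1, h2⟩ <;>
    rcases min_cases (remainderQuot G z y) (K * ‖z‖ ^ (q - 1)) with ⟨h3, h4⟩ | ⟨h3, h4⟩ <;>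
    rw [h1, h3] <;> linarith
  have := mul_le_mul_of_nonneg_right key (norm_nonneg y)
  linarith

end Potential

variable {G : EuclideanSpace ℝ (Fin k) → ℝ} {c p q : ℝ}

theorem measurable_remainderQuot (hG : ContDiff ℝ 1 G) (u h : H n k) :
    Measurable fun x => remainderQuot G (val u x) (val h x) := by
  have h1 : Continuous fun zy : EuclideanSpace ℝ (Fin k) × EuclideanSpace ℝ (Fin k) =>
      |G (zy.1 + zy.2) - G zy.1 - fderiv ℝ G zy.1 zy.2| := by
    have := hG.continuous
    have := hG.continuous_fderiv (by simp)
    fun_prop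
  exact (h1.measurable.comp ((measurable_val u).prodMk (measurable_val h))).div
    (measurable_val h).norm

theorem integrable_potential (hn : 3 ≤ n) (hG : ContDiff ℝ 1 G) (hG0 : G 0 = 0) (hc : 0 ≤ c)
    (hp : 2 < p) (hpq : p ≤ q) (hq : q < critExp n)
    (hDG : ∀ z, ‖fderiv ℝ G z‖ ≤ c * (‖z‖ ^ (p - 1) + ‖z‖ ^ (q - 1))) (u : H n k) :
    Integrable fun x => G (val u x) :=
  (((integrable_rpow_val hn hp.le (hpq.trans hq.le) u).add
    (integrable_rpow_val hn (hp.le.trans hpq) hq.le u)).const_mul c).mono'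
    (hG.continuous.measurable.comp (measurable_val u)).aestronglyMeasurable
    (Eventually.of_forall fun x =>
      abs_le_of_growth hG hG0 hc (by linarith) (by linarith) hDG (val u x))

theorem integrable_fderiv_potential (hn : 3 ≤ n) (hG : ContDiff ℝ 1 G) (hc : 0 ≤ c)
    (hp : 2 < p) (hpq : p ≤ q) (hq : q < critExp n)
    (hDG : ∀ z, ‖fderiv ℝ G z‖ ≤ c * (‖z‖ ^ (p - 1) + ‖z‖ ^ (q - 1))) (u φ : H n k) :
    Integrable (fun x => fderiv ℝ G (val u x) (val φ x)) ∧
    |∫ x, fderiv ℝ G (val u x) (val φ x)| ≤ c *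
      ((∫ x, ‖val u x‖ ^ p) ^ ((p - 1) / p) * (∫ x, ‖val φ x‖ ^ p) ^ (1 / p)
      + (∫ x, ‖val u x‖ ^ q) ^ ((q - 1) / q) * (∫ x, ‖val φ x‖ ^ q) ^ (1 / q)) := by
  have hP := integral_rpow_mul_norm_le (s := p) (by linarith)
    (memLp_val hn hp.le (hpq.trans hq.le) u) (memLp_val hn hp.le (hpq.trans hq.le) φ)
  have hQ := integral_rpow_mul_norm_le (s := q) (by linarith)
    (memLp_val hn (hp.le.trans hpq) hq.le u) (memLp_val hn (hp.le.trans hpq) hq.le φ)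
  have hbd : ∀ x, ‖fderiv ℝ G (val u x) (val φ x)‖ ≤ c * (‖val u x‖ ^ (p - 1) * ‖val φ x‖
      + ‖val u x‖ ^ (q - 1) * ‖val φ x‖) := fun x => by
    refine ((fderiv ℝ G (val u x)).le_opNorm _).trans ?_
    have := mul_le_mul_of_nonneg_right (hDG (val u x)) (norm_nonneg (val φ x))
    linarith
  have hI := (hP.1.add hQ.1).const_mul c
  have hcont : Continuous fun zy : EuclideanSpace ℝ (Fin k) × EuclideanSpace ℝ (Fin k) =>
      fderiv ℝ G zy.1 zy.2 := by
    have := hG.continuous_fderiv (by simp)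
    fun_prop
  refine ⟨hI.mono' (hcont.measurable.comp
    ((measurable_val u).prodMk (measurable_val φ))).aestronglyMeasurable
    (Eventually.of_forall hbd), ?_⟩
  refine (norm_integral_le_of_norm_le hI (Eventually.of_forall hbd)).trans ?_
  simp only [Pi.add_apply]
  rw [integral_const_mul, integral_add hP.1 hQ.1]
  exact mul_le_mul_of_nonneg_left (add_le_add hP.2 hQ.2) hc

end

/-! ### Differentiability of the potential energy -/

section

variable {n k : ℕ} {G : EuclideanSpace ℝ (Fin k) → ℝ} {c p q : ℝ}

instance : NormedSpace ℝ (H n k) := inferInstance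

theorem exists_subseq_ae_tendsto_val {h : ℕ → H n k} (hh : Tendsto h atTop (𝓝 0)) :
    ∃ ns : ℕ → ℕ, StrictMono ns ∧ ∀ᵐ x, Tendsto (fun i => val (h (ns i)) x) atTop (𝓝 0) := by
  have h1 : Tendsto (fun i => eLpNorm (val (h i) - 0) 2 (volume : Measure (Rn n))) atTop (𝓝 0) := by
    have h2 : Tendsto (fun i => ∑ _j : Fin k, ENNReal.ofReal ‖h i‖) atTop (𝓝 0) := by
      have h3 := ENNReal.tendsto_ofReal hh.norm
      rw [norm_zero, ENNReal.ofReal_zero] at h3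
      simpa using tendsto_finsetSum (Finset.univ : Finset (Fin k)) fun _ _ => h3
    refine tendsto_of_tendsto_of_tendsto_of_le_of_le tendsto_const_nhds h2 (fun _ => zero_le)
      fun i => ?_
    simp only [sub_zero]
    refine (eLpNorm_val_le _ one_le_two).trans (Finset.sum_le_sum fun j _ => ?_)
    exact (eLpNorm_eq_ofReal_norm _).le.trans
      (ENNReal.ofReal_le_ofReal ((norm_fst_le _).trans (norm_comp_le _ j)))
  exact (tendstoInMeasure_of_tendsto_eLpNorm (by norm_num)
    (fun i => (measurable_val _).aestronglyMeasurable)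
    aestronglyMeasurable_zero h1).exists_seq_tendsto_ae

/-- Truncating the quotient provides the majorant `K ^ (s / (s - 1)) * ‖u‖ ^ s`, which does not
depend on `h`. Dominated convergence then applies along subsequences on which `h → 0` almost
everywhere, and these exist within every null sequence of `H`. -/
theorem tendsto_integral_min_remainderQuot (hn : 3 ≤ n) (hG : ContDiff ℝ 1 G) (u : H n k) {s K : ℝ}
    (hs : 2 ≤ s) (hsr : s ≤ critExp n) (hK : 0 ≤ K) :
    Tendsto (fun h : H n k => ∫ x, (min (remainderQuot G (val u x) (val h x))
      (K * ‖val u x‖ ^ (s - 1))) ^ (s / (s - 1))) (𝓝 0) (𝓝 0) := by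
  have hs1 : 0 < s - 1 := by linarith
  have hpos : 0 < s / (s - 1) := by positivity
  have hnn : ∀ (h : H n k) x, 0 ≤ min (remainderQuot G (val u x) (val h x))
      (K * ‖val u x‖ ^ (s - 1)) := fun h x =>
    le_min (remainderQuot_nonneg _ _) (by positivity)
  apply tendsto_of_seq_tendsto
  intro h hh
  apply tendsto_of_subseq_tendsto
  intro ns hns
  obtain ⟨ms, _, hms⟩ := exists_subseq_ae_tendsto_val (hh.comp hns)
  refine ⟨ms, ?_⟩
  have := tendsto_integral_of_dominated_convergence (μ := (volume : Measure (Rn n)))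
    (F := fun i x => (min (remainderQuot G (val u x) (val (h (ns (ms i))) x))
      (K * ‖val u x‖ ^ (s - 1))) ^ (s / (s - 1))) (f := fun _ => 0)
    (fun x => K ^ (s / (s - 1)) * ‖val u x‖ ^ s)
    (fun i => (((measurable_remainderQuot hG u _).min
      (((measurable_val u).norm.pow_const _).const_mul K)).pow_const _).aestronglyMeasurable)
    ((integrable_rpow_val hn hs hsr u).const_mul _)
    (fun i => Eventually.of_forall fun x => by
      rw [Real.norm_of_nonneg (Real.rpow_nonneg (hnn _ x) _)]
      refine (Real.rpow_le_rpow (hnn _ x) (min_le_right _ _) hpos.le).trans (le_of_eq ?_)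
      rw [Real.mul_rpow hK (by positivity), ← Real.rpow_mul (norm_nonneg _),
        mul_div_cancel₀ _ hs1.ne'])
    (by
      filter_upwards [hms] with x hx
      have h1 := (tendsto_remainderQuot hG (val u x) hx).min
        (tendsto_const_nhds (x := K * ‖val u x‖ ^ (s - 1)))
      have h2 := h1.rpow_const (p := s / (s - 1)) (Or.inr hpos.le)
      rwa [min_eq_left (by positivity), Real.zero_rpow hpos.ne'] at h2)
  simpa using this

/-- The part of the remainder of order `s` is of first order small. -/
theorem exists_bound_remainder (hn : 3 ≤ n) (hG : ContDiff ℝ 1 G) (u : H n k) {s K : ℝ}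
    (hs : 2 ≤ s) (hsr : s ≤ critExp n) (hK : 0 ≤ K) : ∃ b : H n k → ℝ, Tendsto b (𝓝 0) (𝓝 0) ∧
      ∀ h : H n k, Integrable (fun x => min (remainderQuot G (val u x) (val h x))
        (K * ‖val u x‖ ^ (s - 1)) * ‖val h x‖ + K * ‖val h x‖ ^ s) ∧
      ∫ x, (min (remainderQuot G (val u x) (val h x)) (K * ‖val u x‖ ^ (s - 1)) * ‖val h x‖
        + K * ‖val h x‖ ^ s) ≤ b h * ‖h‖ := by
  have hs1 : 0 < s - 1 := by linarith
  have hs0 : 0 < s := by linarith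
  obtain ⟨C, hC0, hC⟩ := exists_integral_rpow_val_le hn k hs hsr
  have hA := tendsto_integral_min_remainderQuot hn hG u hs hsr hK
  obtain ⟨A, hAdef⟩ : ∃ A : H n k → ℝ, ∀ h, A h = ∫ x, (min (remainderQuot G (val u x) (val h x))
      (K * ‖val u x‖ ^ (s - 1))) ^ (s / (s - 1)) := ⟨_, fun _ => rfl⟩
  simp_rw [← hAdef] at hA
  -- The first summand comes from Hölder's inequality for the truncated quotient together with the
  -- Sobolev embedding, the second from `∫ ‖h‖ ^ s ≤ C ‖h‖ ^ s`; it tends to zero because `s > 1`.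
  refine ⟨fun h => A h ^ ((s - 1) / s) * C ^ (1 / s) + K * (C * ‖h‖ ^ (s - 1)), ?_, fun h => ?_⟩
  · have h1 := hA.rpow_const (p := (s - 1) / s) (Or.inr (by positivity))
    rw [Real.zero_rpow (by positivity)] at h1
    have h2 : Tendsto (fun h : H n k => ‖h‖ ^ (s - 1)) (𝓝 0) (𝓝 0) := by
      have h3 := (tendsto_norm_zero (E := H n k)).rpow_const (p := s - 1) (Or.inr hs1.le)
      rwa [Real.zero_rpow hs1.ne'] at h3
    simpa using (h1.mul_const (C ^ (1 / s))).add ((h2.const_mul C).const_mul K)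
  · have hmm0 : Measurable fun x : Rn n => K * ‖val u x‖ ^ (s - 1) :=
      ((measurable_val u).norm.pow_const (s - 1)).const_mul K
    have hmm : Measurable fun x : Rn n => min (remainderQuot G (val u x) (val h x))
        (K * ‖val u x‖ ^ (s - 1)) :=
      (measurable_remainderQuot hG u h).min hmm0
    have hm := hmm.aestronglyMeasurable (μ := volume)
    have hm0 : ∀ x, 0 ≤ min (remainderQuot G (val u x) (val h x)) (K * ‖val u x‖ ^ (s - 1)) :=
      fun x => le_min (remainderQuot_nonneg _ _) (by positivity)
    have hmK : ∀ x, min (remainderQuot G (val u x) (val h x)) (K * ‖val u x‖ ^ (s - 1))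
        ≤ K * ‖val u x‖ ^ (s - 1) := fun x => min_le_right _ _
    have hf := memLp_val hn hs hsr u
    have hg := memLp_val hn hs hsr h
    obtain ⟨h1, -, h2⟩ := integral_mul_norm_le (by linarith) hf hg hm hm0 hmK
    have h3 := (integrable_rpow_val hn hs hsr h).const_mul K
    refine ⟨h1.add h3, ?_⟩
    rw [integral_add h1 h3, integral_const_mul]
    rw [← hAdef] at h2
    have hAn : 0 ≤ A h := (hAdef h).symm ▸ integral_nonneg fun x => Real.rpow_nonneg (hm0 x) _
    have h4 : (∫ x, ‖val h x‖ ^ s) ^ (1 / s) ≤ C ^ (1 / s) * ‖h‖ := by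
      refine (Real.rpow_le_rpow (integral_nonneg fun x => by positivity) (hC h)
        (by positivity)).trans (le_of_eq ?_)
      rw [Real.mul_rpow hC0 (by positivity), ← Real.rpow_mul (norm_nonneg _),
        mul_one_div_cancel hs0.ne', Real.rpow_one]
    have h5 : ‖h‖ ^ s = ‖h‖ ^ (s - 1) * ‖h‖ := by
      rw [← Real.rpow_add_one' (norm_nonneg _) (by linarith), sub_add_cancel]
    have h6 := hC h
    rw [h5] at h6
    have h7 := h2.trans (mul_le_mul_of_nonneg_left h4 (Real.rpow_nonneg hAn _))
    have h8 := mul_le_mul_of_nonneg_left h6 hK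
    linarith

theorem rpow_integral_le_of_le {s C : ℝ} (hs : 0 < s) (hC0 : 0 ≤ C) {φ : H n k}
    (hC : ∫ x, ‖val φ x‖ ^ s ≤ C * ‖φ‖ ^ s) :
    (∫ x, ‖val φ x‖ ^ s) ^ (1 / s) ≤ C ^ (1 / s) * ‖φ‖ := by
  refine (Real.rpow_le_rpow (integral_nonneg fun x => by positivity) hC
    (by positivity)).trans (le_of_eq ?_)
  rw [Real.mul_rpow hC0 (by positivity), ← Real.rpow_mul (norm_nonneg _),
    mul_one_div_cancel hs.ne', Real.rpow_one]

/-- The derivative of `u ↦ ∫ G(u)` as a continuous linear functional. -/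
theorem exists_potentialDeriv (hn : 3 ≤ n) (hG : ContDiff ℝ 1 G)
    (hc : 0 ≤ c) (hp : 2 < p) (hpq : p ≤ q) (hq : q < critExp n)
    (hDG : ∀ z, ‖fderiv ℝ G z‖ ≤ c * (‖z‖ ^ (p - 1) + ‖z‖ ^ (q - 1))) (u : H n k) :
    ∃ L : H n k →L[ℝ] ℝ, ∀ φ, L φ = ∫ x, fderiv ℝ G (val u x) (val φ x) := by
  have hint := integrable_fderiv_potential hn hG hc hp hpq hq hDG u
  obtain ⟨Cp, hCp0, hCp⟩ := exists_integral_rpow_val_le hn k hp.le (hpq.trans hq.le)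
  obtain ⟨Cq, hCq0, hCq⟩ := exists_integral_rpow_val_le hn k (hp.le.trans hpq) hq.le
  let L₀ : H n k →ₗ[ℝ] ℝ :=
    { toFun := fun φ => ∫ x, fderiv ℝ G (val u x) (val φ x)
      map_add' := fun φ ψ => by
        rw [← integral_add (hint φ).1 (hint ψ).1]
        apply integral_congr_ae
        filter_upwards [val_add φ ψ] with x hx
        rw [hx, map_add]
      map_smul' := fun a φ => by
        rw [RingHom.id_apply, smul_eq_mul, ← integral_const_mul]
        apply integral_congr_ae
        filter_upwards [val_smul a φ] with x hx
        rw [hx, map_smul, smul_eq_mul] }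
  refine ⟨L₀.mkContinuous
    (c * ((∫ x, ‖val u x‖ ^ p) ^ ((p - 1) / p) * Cp ^ (1 / p)
      + (∫ x, ‖val u x‖ ^ q) ^ ((q - 1) / q) * Cq ^ (1 / q))) (fun φ => ?_), fun φ => rfl⟩
  have h1 := rpow_integral_le_of_le (by linarith) hCp0 (hCp φ)
  have h2 := rpow_integral_le_of_le (by linarith) hCq0 (hCq φ)
  have h3 : 0 ≤ (∫ x, ‖val u x‖ ^ p) ^ ((p - 1) / p) :=
    Real.rpow_nonneg (integral_nonneg fun x => by positivity) _
  have h4 : 0 ≤ (∫ x, ‖val u x‖ ^ q) ^ ((q - 1) / q) :=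
    Real.rpow_nonneg (integral_nonneg fun x => by positivity) _
  refine (hint φ).2.trans ?_
  rw [mul_assoc]
  refine mul_le_mul_of_nonneg_left ?_ hc
  linarith [mul_le_mul_of_nonneg_left h1 h3, mul_le_mul_of_nonneg_left h2 h4]

/-- The functional `u ↦ ∫ G(u)` is differentiable on `H`. -/
theorem exists_hasFDerivAt_potential (hn : 3 ≤ n) (hG : ContDiff ℝ 1 G) (hG0 : G 0 = 0)
    (hc : 0 ≤ c) (hp : 2 < p) (hpq : p ≤ q) (hq : q < critExp n)
    (hDG : ∀ z, ‖fderiv ℝ G z‖ ≤ c * (‖z‖ ^ (p - 1) + ‖z‖ ^ (q - 1))) (u : H n k) :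
    ∃ L : H n k →L[ℝ] ℝ, (∀ φ, L φ = ∫ x, fderiv ℝ G (val u x) (val φ x)) ∧
      HasFDerivAt (fun u : H n k => ∫ x, G (val u x)) L u := by
  have hint := integrable_fderiv_potential hn hG hc hp hpq hq hDG u
  obtain ⟨L, hL⟩ := exists_potentialDeriv hn hG hc hp hpq hq hDG u
  refine ⟨L, hL, ?_⟩
  set K := c * (2 ^ (q - 1) + 1) with hKdef
  have hK : 0 ≤ K := by positivity
  obtain ⟨bp, hbp, hbp'⟩ := exists_bound_remainder hn hG u hp.le (hpq.trans hq.le) hK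
  obtain ⟨bq, hbq, hbq'⟩ := exists_bound_remainder hn hG u (hp.le.trans hpq) hq.le hK
  rw [hasFDerivAt_iff_isLittleO_nhds_zero, Asymptotics.isLittleO_iff]
  intro ε hε
  have hb := hbp.add hbq
  rw [add_zero] at hb
  filter_upwards [hb.eventually_le_const hε] with h hh
  have hGi := integrable_potential hn hG hG0 hc hp hpq hq hDG
  have e1 : (∫ x, G (val (u + h) x)) - (∫ x, G (val u x)) - L h
      = ∫ x, (G (val u x + val h x) - G (val u x) - fderiv ℝ G (val u x) (val h x)) := by
    have h1 : Integrable fun x => G (val u x + val h x) := by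
      refine (hGi (u + h)).congr ?_
      filter_upwards [val_add u h] with x hx
      rw [hx]
    have h2 : ∫ x, G (val (u + h) x) = ∫ x, G (val u x + val h x) := by
      apply integral_congr_ae
      filter_upwards [val_add u h] with x hx
      rw [hx]
    have h3 : Integrable fun x => G (val u x + val h x) - G (val u x) := h1.sub (hGi u)
    rw [integral_sub h3 (hint h).1, integral_sub h1 (hGi u), h2, hL]
  rw [e1]
  refine (norm_integral_le_of_norm_le ((hbp' h).1.add (hbq' h).1)
    (Eventually.of_forall fun x => abs_remainder_le hK
      (remainderQuot_le hG hc (by linarith) hpq hDG (val u x) (val h x))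
      (by linarith) (by linarith))).trans ?_
  simp only [Pi.add_apply]
  rw [integral_add (hbp' h).1 (hbq' h).1]
  calc _ ≤ bp h * ‖h‖ + bq h * ‖h‖ := add_le_add (hbp' h).2 (hbq' h).2
    _ = (bp h + bq h) * ‖h‖ := by ring
    _ ≤ ε * ‖h‖ := mul_le_mul_of_nonneg_right hh (norm_nonneg _)

end

/-! ### First variation on the constraint -/

section

variable {n k : ℕ} {G : EuclideanSpace ℝ (Fin k) → ℝ} {c p q : ℝ} {m : Fin k → ℝ}

section Abstract

variable {X Y Y' E : Type*} [NormedAddCommGroup X] [NormedSpace ℝ X] [NormedAddCommGroup E]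
  [NormedSpace ℝ E] [NormedAddCommGroup Y] [InnerProductSpace ℝ Y] [NormedAddCommGroup Y']
  [InnerProductSpace ℝ Y']

/-- The charge in abstract form: `A` is `u ↦ uⱼ` with values in `L²`, and `pr` is the coordinate
`ωⱼ`. -/
theorem exists_hasFDerivAt_mul_norm_sq (A : X →L[ℝ] Y) (pr : E →L[ℝ] ℝ) (z : X × E) :
    ∃ L : X × E →L[ℝ] ℝ, HasFDerivAt (fun z : X × E => pr z.2 * ‖A z.1‖ ^ 2) L z ∧ ∀ φ η,
      L (φ, η) = pr η * ‖A z.1‖ ^ 2 + 2 * pr z.2 * inner ℝ (A z.1) (A φ) := by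
  have h1 := (A.comp (ContinuousLinearMap.fst ℝ X E)).hasFDerivAt (x := z) |>.norm_sq
  have h2 := (pr.comp (ContinuousLinearMap.snd ℝ X E)).hasFDerivAt (x := z)
  refine ⟨_, h2.mul h1, fun φ η => ?_⟩
  simp
  ring

/-- One quadratic summand of twice the energy: `A` is the component, `B` its gradient, and `a =
mⱼ²`. -/
theorem exists_hasFDerivAt_quadratic (A : X →L[ℝ] Y) (B : X →L[ℝ] Y') (pr : E →L[ℝ] ℝ) (a : ℝ)
    (z : X × E) : ∃ L : X × E →L[ℝ] ℝ,
      HasFDerivAt (fun z : X × E => ‖B z.1‖ ^ 2 + (a + pr z.2 ^ 2) * ‖A z.1‖ ^ 2) L z ∧ ∀ φ η,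
      L (φ, η) = 2 * (inner ℝ (B z.1) (B φ) + (a + pr z.2 ^ 2) * inner ℝ (A z.1) (A φ)
        + pr z.2 * pr η * ‖A z.1‖ ^ 2) := by
  have h1 := (A.comp (ContinuousLinearMap.fst ℝ X E)).hasFDerivAt (x := z) |>.norm_sq
  have h2 := (pr.comp (ContinuousLinearMap.snd ℝ X E)).hasFDerivAt (x := z)
  have h3 := (B.comp (ContinuousLinearMap.fst ℝ X E)).hasFDerivAt (x := z) |>.norm_sq
  refine ⟨_, h3.add (((h2.pow 2).const_add a).mul h1), fun φ η => ?_⟩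
  simp
  ring

theorem exists_hasFDerivAt_sum_add {ι : Type*} [Fintype ι] {f : ι → X × E → ℝ} {Ψ : X → ℝ}
    {f' : ι → X × E →L[ℝ] ℝ} {Ψ' : X →L[ℝ] ℝ} {z : X × E} (hf : ∀ j, HasFDerivAt (f j) (f' j) z)
    (hΨ : HasFDerivAt Ψ Ψ' z.1) : ∃ L : X × E →L[ℝ] ℝ,
      HasFDerivAt (fun z : X × E => 1 / 2 * ∑ j, f j z + Ψ z.1) L z ∧ ∀ φ η,
      L (φ, η) = 1 / 2 * ∑ j, f' j (φ, η) + Ψ' φ := by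
  have h1 := (HasFDerivAt.fun_sum (u := Finset.univ) fun j _ => hf j).const_mul (1 / 2)
  have h2 := hΨ.comp z (ContinuousLinearMap.fst ℝ X E).hasFDerivAt
  refine ⟨_, h1.add h2, fun φ η => ?_⟩
  simp

theorem integral_add_mul_add_mul {α : Type*} [MeasurableSpace α] {μ : Measure α} {f g h : α → ℝ}
    (hf : Integrable f μ) (hg : Integrable g μ) (hh : Integrable h μ) (a b : ℝ) :
    ∫ x, (f x + a * g x + b * h x) ∂μ = (∫ x, f x ∂μ) + a * (∫ x, g x ∂μ) + b * ∫ x, h x ∂μ := by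
  have i1 : Integrable (fun x => f x + a * g x) μ := hf.add (hg.const_mul a)
  rw [integral_add i1 (hh.const_mul b), integral_add hf (hg.const_mul a), integral_const_mul,
    integral_const_mul]

/-- The first variation of a functional of the form
`½ ∑ⱼ (‖Bⱼ x‖² + (aⱼ + ωⱼ²) ‖Aⱼ x‖²) + Ψ(x)` on the set where `ωⱼ ‖Aⱼ x‖² = σⱼ`, after elimination
of `ω`. -/
theorem abs_firstVariation_le {A : Fin k → X →L[ℝ] Y} {B : Fin k → X →L[ℝ] Y'} {a : Fin k → ℝ}
    {Ψ : X → ℝ} {Ψ' : X →L[ℝ] ℝ} {u : X} {ω : EuclideanSpace ℝ (Fin k)} (hA : ∀ j x, ‖A j x‖ ≤ ‖x‖)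
    (hΨ : HasFDerivAt Ψ Ψ' u) {En : X × EuclideanSpace ℝ (Fin k) → ℝ}
    (hE : ∀ z, En z = 1 / 2 * ∑ j, (‖B j z.1‖ ^ 2 + (a j + z.2 j ^ 2) * ‖A j z.1‖ ^ 2) + Ψ z.1)
    {C : Fin k → X × EuclideanSpace ℝ (Fin k) → ℝ} (hC : ∀ j z, C j z = z.2 j * ‖A j z.1‖ ^ 2)
    {σ : Fin k → ℝ} (hσ : ∀ j, 0 < σ j) (hCσ : ∀ j, C j (u, ω) = σ j) (hω : ∀ j, 0 ≤ ω j)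
    {W : ℝ} (hW : ∀ j, ω j ≤ W) {R : Submodule ℝ X}
    {T : Submodule ℝ (X × EuclideanSpace ℝ (Fin k))}
    (hRT : ∀ v, v.1 ∈ R → (∀ j, fderiv ℝ (C j) (u, ω) v = 0) → v ∈ T) {φ : X} (hφ : φ ∈ R) :
    |∑ j, (inner ℝ (B j u) (B j φ) + (a j - ω j ^ 2) * inner ℝ (A j u) (A j φ)) + Ψ' φ| ≤
      ‖(fderiv ℝ En (u, ω)).comp T.subtypeL‖ * ((1 + ∑ j, 2 * Real.sqrt (W ^ 3 / σ j)) * ‖φ‖) := by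
  have hCs : ∀ j, ω j * ‖A j u‖ ^ 2 = σ j := fun j => (hC j (u, ω)).symm.trans (hCσ j)
  have hune : ∀ j, ‖A j u‖ ^ 2 ≠ 0 := fun j h0 => by
    have h1 := hCs j
    rw [h0, mul_zero] at h1
    exact (hσ j).ne h1
  -- The solution of the linearised constraint `ηⱼ ‖Aⱼ u‖² + 2 ωⱼ (Aⱼ u, Aⱼ φ) = 0`; the division is
  -- legitimate because `σⱼ > 0` forces `Aⱼ u ≠ 0`.
  let η : EuclideanSpace ℝ (Fin k) := WithLp.toLp 2 fun j =>
    -(2 * ω j * inner ℝ (A j u) (A j φ)) / ‖A j u‖ ^ 2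
  have hη : ∀ j, η j * ‖A j u‖ ^ 2 = -(2 * ω j * inner ℝ (A j u) (A j φ)) :=
    fun j => div_mul_cancel₀ _ (hune j)
  have hT : (φ, η) ∈ T := by
    refine hRT _ hφ fun j => ?_
    obtain ⟨L, hL, hL'⟩ := exists_hasFDerivAt_mul_norm_sq (A j)
      (EuclideanSpace.proj (𝕜 := ℝ) j) (u, ω)
    have hL1 : HasFDerivAt (C j) L (u, ω) :=
      hL.congr_of_eventuallyEq (Eventually.of_forall fun z => hC j z)
    rw [hL1.fderiv]
    refine (hL' φ η).trans ?_
    simp only [PiLp.proj_apply]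
    rw [hη]
    ring
  choose Lj hLj hLj' using fun j => exists_hasFDerivAt_quadratic (A j) (B j)
    (EuclideanSpace.proj (𝕜 := ℝ) j) (a j) (u, ω)
  obtain ⟨L, hL0, hL'⟩ := exists_hasFDerivAt_sum_add hLj hΨ
  have hL : HasFDerivAt En L (u, ω) :=
    hL0.congr_of_eventuallyEq (Eventually.of_forall fun z => hE z)
  have h1 := ((fderiv ℝ En (u, ω)).comp T.subtypeL).le_opNorm ⟨_, hT⟩
  -- The variation of `ω` contributes `ωⱼ ηⱼ ‖Aⱼ u‖² = -2 ωⱼ² (Aⱼ u, Aⱼ φ)`, which reverses the sign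
  -- of the `ωⱼ²` term.
  have h2 : ((fderiv ℝ En (u, ω)).comp T.subtypeL) ⟨_, hT⟩
      = ∑ j, (inner ℝ (B j u) (B j φ) + (a j - ω j ^ 2) * inner ℝ (A j u) (A j φ)) + Ψ' φ := by
    rw [hL.fderiv]
    refine (hL' φ η).trans ?_
    congr 1
    rw [Finset.mul_sum]
    refine Finset.sum_congr rfl fun j _ => ?_
    rw [hLj']
    simp only [PiLp.proj_apply]
    rw [mul_assoc (ω j), hη]
    ring
  rw [h2, Real.norm_eq_abs] at h1
  refine h1.trans (mul_le_mul_of_nonneg_left ?_ (norm_nonneg _))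
  have hηj : ∀ j, |η j| ≤ 2 * Real.sqrt (W ^ 3 / σ j) * ‖φ‖ := by
    intro j
    have hup : 0 < ‖A j u‖ := by
      rcases (norm_nonneg (A j u)).eq_or_lt with h | h
      · exact absurd (by rw [← h]; norm_num) (hune j)
      · exact h
    -- By the constraint, `ωⱼ² / ‖Aⱼ u‖² = ωⱼ³ / σⱼ`, so an upper bound on `ω` alone controls `η`.
    have e1 : ω j / ‖A j u‖ ≤ Real.sqrt (W ^ 3 / σ j) := by
      apply Real.le_sqrt_of_sq_le
      rw [div_pow, div_le_div_iff₀ (by positivity) (hσ j), ← hCs j]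
      have e2 : ω j ^ 3 ≤ W ^ 3 := pow_le_pow_left₀ (hω j) (hW j) 3
      have := mul_le_mul_of_nonneg_right e2 (sq_nonneg ‖A j u‖)
      linarith
    have e3 : |inner ℝ (A j u) (A j φ)| ≤ ‖A j u‖ * ‖φ‖ :=
      (abs_real_inner_le_norm _ _).trans (mul_le_mul_of_nonneg_left (hA j φ) hup.le)
    have e4 : |η j| = 2 * ω j * |inner ℝ (A j u) (A j φ)| / ‖A j u‖ ^ 2 := by
      change |-(2 * ω j * inner ℝ (A j u) (A j φ)) / ‖A j u‖ ^ 2| = _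
      rw [abs_div, abs_neg, abs_mul, abs_mul, abs_of_nonneg (hω j), abs_two,
        abs_of_pos (pow_pos hup 2)]
    rw [e4]
    calc _ ≤ 2 * ω j * (‖A j u‖ * ‖φ‖) / ‖A j u‖ ^ 2 := by
          gcongr
          exact mul_nonneg zero_le_two (hω j)
      _ = 2 * (ω j / ‖A j u‖) * ‖φ‖ := by
          field_simp
      _ ≤ _ := by gcongr
  have hηn : ‖η‖ ≤ ∑ j, |η j| := by
    have : η = ∑ j, EuclideanSpace.single j (η j) := by
      ext i
      simp [Finset.sum_apply, Pi.single_apply]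
    calc ‖η‖ = ‖∑ j, EuclideanSpace.single j (η j)‖ := congrArg _ this
      _ ≤ ∑ j, ‖EuclideanSpace.single j (η j)‖ := norm_sum_le _ _
      _ = _ := by simp
  have h3 : max ‖φ‖ ‖η‖ ≤ ‖φ‖ + ‖η‖ := max_le_add_of_nonneg (norm_nonneg _) (norm_nonneg _)
  refine h3.trans ?_
  rw [add_mul, one_mul, Finset.sum_mul]
  exact add_le_add le_rfl (hηn.trans (Finset.sum_le_sum fun j _ => hηj j))

/-- The energy puts `2 k⁻¹ G` into each of its `k` summands; together with the factor `1 / 2` they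
add up to a single `∫ G`. -/
theorem half_mul_sum_add_const (hk : k ≠ 0) (a : Fin k → ℝ) (I : ℝ) :
    1 / 2 * ∑ j, (a j + 2 * (k : ℝ)⁻¹ * I) = 1 / 2 * ∑ j, a j + I := by
  have hk' : (k : ℝ) ≠ 0 := by exact_mod_cast hk
  rw [Finset.sum_add_distrib, Finset.sum_const, Finset.card_univ, Fintype.card_fin, nsmul_eq_mul]
  field_simp

end Abstract

/-- The component `u ↦ uⱼ` as a continuous linear map into `L²`. -/
def compL (n : ℕ) {k : ℕ} (j : Fin k) : H n k →L[ℝ] Lp ℝ 2 (volume : Measure (Rn n)) :=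
  LinearMap.mkContinuous
    { toFun := fun u => (u j).1.fst
      map_add' := fun _ _ => rfl
      map_smul' := fun _ _ => rfl } 1 fun u => by
    rw [one_mul]
    exact (norm_fst_le (u j)).trans (norm_comp_le u j)

/-- The gradient `u ↦ D uⱼ` as a continuous linear map into `L²`. -/
def gradL (n : ℕ) {k : ℕ} (j : Fin k) : H n k →L[ℝ] Lp (Rn n) 2 (volume : Measure (Rn n)) :=
  LinearMap.mkContinuous
    { toFun := fun u => (u j).1.snd
      map_add' := fun _ _ => rfl
      map_smul' := fun _ _ => rfl } 1 fun u => by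
    rw [one_mul]
    exact (norm_snd_le (u j)).trans (norm_comp_le u j)

theorem compL_apply (u : H n k) (j : Fin k) : compL n j u = (u j).1.fst := rfl

theorem gradL_apply (u : H n k) (j : Fin k) : gradL n j u = (u j).1.snd := rfl

attribute [irreducible] compL gradL

theorem norm_sq_eq_sum (u : H n k) : ‖u‖ ^ 2 = ∑ j, (‖compL n j u‖ ^ 2 + ‖gradL n j u‖ ^ 2) := by
  simp_rw [compL_apply, gradL_apply]
  exact norm_sq_eq u

theorem norm_compL_le (u : H n k) (j : Fin k) : ‖compL n j u‖ ≤ ‖u‖ := by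
  rw [compL_apply]
  exact (norm_fst_le (u j)).trans (norm_comp_le u j)

theorem charge_eq (j : Fin k) (z : Pairs n k) : charge j z = z.2 j * ‖compL n j z.1‖ ^ 2 := by
  rw [charge, integral_sq_comp, compL_apply]

theorem integrable_sq_gradComp (u : H n k) (j : Fin k) :
    Integrable fun x => ‖gradComp u j x‖ ^ 2 :=
  (Lp.memLp (u j).1.snd).norm.integrable_sq

theorem energy_eq (hk : k ≠ 0) {u : H n k} (hG : Integrable fun x => G (val u x))
    (ω : EuclideanSpace ℝ (Fin k)) : energy m G (u, ω) =
      1 / 2 * ∑ j, (‖gradL n j u‖ ^ 2 + (m j ^ 2 + ω j ^ 2) * ‖compL n j u‖ ^ 2)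
        + ∫ x, G (val u x) := by
  rw [energy, ← half_mul_sum_add_const hk]
  congr 1
  refine Finset.sum_congr rfl fun j _ => ?_
  refine (integral_add_mul_add_mul (integrable_sq_gradComp u j) (integrable_sq_comp u j) hG
    _ _).trans ?_
  rw [integral_sq_comp, integral_sq_gradComp, compL_apply, gradL_apply]

theorem mem_tangent {z : Pairs n k} (v : Pairs n k) (hv : v.1 ∈ radial n k)
    (h : ∀ j, fderiv ℝ (charge (n := n) j) z v = 0) : v ∈ tangent z := by
  refine ⟨⟨hv, trivial⟩, ?_⟩
  rw [SetLike.mem_coe, Submodule.mem_iInf]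
  exact h

theorem abs_firstVariation_energy_le {Ψ' : H n k →L[ℝ] ℝ} {u : H n k}
    {ω : EuclideanSpace ℝ (Fin k)} (hΨ : HasFDerivAt (fun u : H n k => ∫ x, G (val u x)) Ψ' u)
    (hE : ∀ z : Pairs n k, energy m G z = 1 / 2 * ∑ j, (‖gradL n j z.1‖ ^ 2
      + (m j ^ 2 + z.2 j ^ 2) * ‖compL n j z.1‖ ^ 2) + ∫ x, G (val z.1 x))
    {σ : Fin k → ℝ} (hσ : ∀ j, 0 < σ j) (hz : (u, ω) ∈ constraintRadial n σ) {W : ℝ}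
    (hW : ∀ j, ω j ≤ W) {φ : H n k} (hφ : φ ∈ radial n k) :
    |∑ j, (inner ℝ (gradL n j u) (gradL n j φ)
        + (m j ^ 2 - ω j ^ 2) * inner ℝ (compL n j u) (compL n j φ)) + Ψ' φ| ≤
      ‖(fderiv ℝ (energy m G) (u, ω)).comp (tangent (u, ω)).subtypeL‖
        * ((1 + ∑ j, 2 * Real.sqrt (W ^ 3 / σ j)) * ‖φ‖) :=
  abs_firstVariation_le (A := compL n) (B := gradL n) (a := fun j => m j ^ 2)
    (Ψ := fun u : H n k => ∫ x, G (val u x)) (u := u) (ω := ω) (Ψ' := Ψ')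
    (fun j x => norm_compL_le x j) hΨ (En := energy m G) hE (C := fun j => charge j) charge_eq hσ
    hz.2.2 hz.2.1 (W := W) hW (R := radial n k) (T := tangent (u, ω)) mem_tangent hφ

/-- The first variation of the energy on the radial constraint, after elimination of `ω`. -/
theorem exists_bound_firstVariation (hk : k ≠ 0) (hn : 3 ≤ n) (hG : ContDiff ℝ 1 G) (hG0 : G 0 = 0)
    (hc : 0 ≤ c) (hp : 2 < p) (hpq : p ≤ q) (hq : q < critExp n)
    (hDG : ∀ z, ‖fderiv ℝ G z‖ ≤ c * (‖z‖ ^ (p - 1) + ‖z‖ ^ (q - 1)))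
    {σ : Fin k → ℝ} (hσ : ∀ j, 0 < σ j) {u : H n k} {ω : EuclideanSpace ℝ (Fin k)}
    (hz : (u, ω) ∈ constraintRadial n σ) {W : ℝ} (hW : ∀ j, ω j ≤ W) {φ : H n k}
    (hφ : φ ∈ radial n k) : ∃ I : ℝ, I = ∫ x, fderiv ℝ G (val u x) (val φ x) ∧
      |∑ j, (inner ℝ (gradL n j u) (gradL n j φ)
        + (m j ^ 2 - ω j ^ 2) * inner ℝ (compL n j u) (compL n j φ)) + I| ≤
      ‖(fderiv ℝ (energy m G) (u, ω)).comp (tangent (u, ω)).subtypeL‖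
        * ((1 + ∑ j, 2 * Real.sqrt (W ^ 3 / σ j)) * ‖φ‖) := by
  have hE : ∀ z : Pairs n k, energy m G z = 1 / 2 * ∑ j, (‖gradL n j z.1‖ ^ 2
      + (m j ^ 2 + z.2 j ^ 2) * ‖compL n j z.1‖ ^ 2) + ∫ x, G (val z.1 x) := fun z =>
    energy_eq hk (integrable_potential hn hG hG0 hc hp hpq hq hDG z.1) z.2
  have h := exists_hasFDerivAt_potential hn hG hG0 hc hp hpq hq hDG u
  exact h.elim fun L hL => ⟨L φ, hL.1 φ, abs_firstVariation_energy_le hL.2 hE hσ hz hW hφ⟩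

end

/-! ### Weak compactness, closedness of the radial subspace, and strong convergence -/

section

variable {n k : ℕ}

/-- Sequential Banach–Alaoglu in the dual of a separable space, carried over to `X` by the Riesz
isomorphism. -/
theorem exists_weak_subseq {X : Type*} [NormedAddCommGroup X] [InnerProductSpace ℝ X]
    [CompleteSpace X] [TopologicalSpace.SeparableSpace X] {x : ℕ → X} {M : ℝ}
    (hM : ∀ i, ‖x i‖ ≤ M) : ∃ s : ℕ → ℕ, StrictMono s ∧ ∃ x' : X, ∀ ℓ : X →L[ℝ] ℝ,
      Tendsto (fun i => ℓ (x (s i))) atTop (𝓝 (ℓ x')) := by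
  have hc := WeakDual.isSeqCompact_closedBall ℝ X 0 M
  have hx : ∀ i, StrongDual.toWeakDual (InnerProductSpace.toDual ℝ X (x i)) ∈
      WeakDual.toStrongDual ⁻¹' Metric.closedBall (0 : StrongDual ℝ X) M := by
    intro i
    change InnerProductSpace.toDual ℝ X (x i) ∈ Metric.closedBall (0 : StrongDual ℝ X) M
    rw [mem_closedBall_zero_iff, LinearIsometryEquiv.norm_map]
    exact hM i
  obtain ⟨a, -, s, hs, ha⟩ := hc hx
  refine ⟨s, hs, (InnerProductSpace.toDual ℝ X).symm (WeakDual.toStrongDual a), fun ℓ => ?_⟩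
  have h1 := ((WeakDual.eval_continuous ((InnerProductSpace.toDual ℝ X).symm ℓ)).tendsto a).comp ha
  have h2 : ∀ y : X, ℓ y = inner ℝ y ((InnerProductSpace.toDual ℝ X).symm ℓ) := fun y => by
    rw [real_inner_comm, InnerProductSpace.toDual_symm_apply]
  rw [h2, InnerProductSpace.toDual_symm_apply]
  refine h1.congr fun i => ?_
  rw [h2]
  rfl

/-- Each test function and direction imposes an equality of two continuous functionals, namely inner
products with fixed `L²` classes. -/
theorem isClosed_sobolevH1 : IsClosed (sobolevH1 n : Set (WithLp 2 (Lp ℝ 2 (volume : Measure (Rn n))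
    × Lp (Rn n) 2 (volume : Measure (Rn n))))) := by
  have h : (sobolevH1 n : Set (WithLp 2 (Lp ℝ 2 (volume : Measure (Rn n))
      × Lp (Rn n) 2 (volume : Measure (Rn n))))) = ⋂ (φ : Rn n → ℝ)
      (_ : ContDiff ℝ ((⊤ : ℕ∞) : WithTop ℕ∞) φ) (_ : HasCompactSupport φ) (v : Rn n),
      {w | ∫ x, w.fst x * fderiv ℝ φ x v = - ∫ x, φ x * inner ℝ (w.snd x) v} := by
    ext w
    simp only [Set.mem_iInter]
    rfl
  rw [h]
  refine isClosed_iInter fun φ => isClosed_iInter fun hφ => isClosed_iInter fun hc =>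
    isClosed_iInter fun v => ?_
  have hm1 : MemLp (fun x => fderiv ℝ φ x v) 2 (volume : Measure (Rn n)) :=
    (continuous_fderiv_of_test hφ v).memLp_of_hasCompactSupport (hc.fderiv_apply (𝕜 := ℝ) v)
  have hm2 : MemLp (fun x => φ x • v) 2 (volume : Measure (Rn n)) :=
    (hφ.continuous.smul continuous_const).memLp_of_hasCompactSupport hc.smul_right
  have e1 : ∀ f : Lp ℝ 2 (volume : Measure (Rn n)),
      ∫ x, f x * fderiv ℝ φ x v = inner ℝ (hm1.toLp _) f := fun f => by
    rw [L2.inner_def]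
    apply integral_congr_ae
    filter_upwards [hm1.coeFn_toLp] with x hx
    rw [hx]
    simp
  have e2 : ∀ f : Lp (Rn n) 2 (volume : Measure (Rn n)),
      ∫ x, φ x * inner ℝ (f x) v = inner ℝ (hm2.toLp _) f := fun f => by
    rw [L2.inner_def]
    apply integral_congr_ae
    filter_upwards [hm2.coeFn_toLp] with x hx
    rw [hx, real_inner_smul_left, real_inner_comm]
  simp_rw [e1, e2]
  have c1 : Continuous fun w : WithLp 2 (Lp ℝ 2 (volume : Measure (Rn n))
      × Lp (Rn n) 2 (volume : Measure (Rn n))) => w.fst :=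
    continuous_fst.comp (WithLp.prod_continuous_ofLp 2 _ _)
  have c2 : Continuous fun w : WithLp 2 (Lp ℝ 2 (volume : Measure (Rn n))
      × Lp (Rn n) 2 (volume : Measure (Rn n))) => w.snd :=
    continuous_snd.comp (WithLp.prod_continuous_ofLp 2 _ _)
  exact isClosed_eq (continuous_const.inner c1) (continuous_const.inner c2).neg

instance : CompleteSpace (sobolevH1 n) := isClosed_sobolevH1.completeSpace_coe

instance : SecondCountableTopology (sobolevH1 n) := by
  have : Fact ((2 : ℝ≥0∞) ≠ ∞) := ⟨by norm_num⟩
  have h1 : SecondCountableTopology (Lp ℝ 2 (volume : Measure (Rn n))) :=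
    Lp.SecondCountableTopology
  have h2 : SecondCountableTopology (Lp (Rn n) 2 (volume : Measure (Rn n))) :=
    Lp.SecondCountableTopology
  have h3 := WithLp.secondCountableTopology 2 (Lp ℝ 2 (volume : Measure (Rn n)))
    (Lp (Rn n) 2 (volume : Measure (Rn n)))
  exact TopologicalSpace.Subtype.secondCountableTopology _

instance : CompleteSpace (H n k) := PiLp.completeSpace 2 _

instance : SecondCountableTopology (H n k) := PiLp.secondCountableTopology 2 _

theorem isClosed_radial : IsClosed (radial n k : Set (H n k)) := by
  rw [← isSeqClosed_iff_isClosed]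
  intro x a hx ha j
  have h1 : Tendsto (fun i => compL n j (x i)) atTop (𝓝 (compL n j a)) :=
    ((compL n j).continuous.tendsto a).comp ha
  obtain ⟨ns, -, hns⟩ := (tendstoInMeasure_of_tendsto_Lp h1).exists_seq_tendsto_ae
  have hx' : ∀ i, ∃ f : ℝ → ℝ, ∀ᵐ y, compL n j (x i) y = f ‖y‖ := fun i => by
    rw [compL_apply]
    exact hx i j
  choose f hf using hx'
  -- The profile of the limit is the pointwise limit of the profiles along an a.e. convergent
  -- subsequence; radii without convergence correspond to a null set of points.
  refine ⟨fun r => limUnder atTop fun i => f (ns i) r, ?_⟩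
  filter_upwards [hns, ae_all_iff.2 hf] with y hy hfy
  simp only [hfy] at hy
  rw [hy.limUnder_eq, compL_apply]
  rfl

/-- A closed subspace is its own double orthogonal complement, so membership is tested by the
functionals `inner y`, which pass to weak limits. -/
theorem mem_of_weak_limit {X : Type*} [NormedAddCommGroup X] [InnerProductSpace ℝ X]
    [CompleteSpace X] {R : Submodule ℝ X} (hR : IsClosed (R : Set X)) {x : ℕ → X} {x' : X}
    (hx : ∀ i, x i ∈ R) (h : ∀ ℓ : X →L[ℝ] ℝ, Tendsto (fun i => ℓ (x i)) atTop (𝓝 (ℓ x'))) :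
    x' ∈ R := by
  rw [← hR.submodule_topologicalClosure_eq, ← Submodule.orthogonal_orthogonal_eq_closure,
    Submodule.mem_orthogonal]
  intro y hy
  have h1 := h (innerSL ℝ y)
  have h2 : ∀ i, innerSL ℝ y (x i) = 0 := fun i => by
    rw [innerSL_apply_apply, real_inner_comm]
    exact hy _ (hx i)
  simp_rw [h2] at h1
  exact (tendsto_nhds_unique h1 tendsto_const_nhds)

/-- Weakly convergent sequences converge strongly if a definite quadratic expression does. -/
theorem tendsto_of_quadratic {X Y Y' : Type*} [NormedAddCommGroup X] [NormedSpace ℝ X]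
    [NormedAddCommGroup Y] [InnerProductSpace ℝ Y] [NormedAddCommGroup Y'] [InnerProductSpace ℝ Y']
    {A : Fin k → X →L[ℝ] Y} {B : Fin k → X →L[ℝ] Y'}
    (hN : ∀ x, ‖x‖ ^ 2 = ∑ j, (‖A j x‖ ^ 2 + ‖B j x‖ ^ 2)) {x : ℕ → X} {x' : X}
    {d : ℕ → Fin k → ℝ} {d' : Fin k → ℝ} (hd : ∀ j, Tendsto (fun i => d i j) atTop (𝓝 (d' j)))
    {δ : ℝ} (hδ : 0 < δ) (hδ1 : δ ≤ 1) (hdδ : ∀ᶠ i in atTop, ∀ j, δ ≤ d i j)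
    (hweak : ∀ ℓ : X →L[ℝ] ℝ, Tendsto (fun i => ℓ (x i)) atTop (𝓝 (ℓ x')))
    (hS : Tendsto (fun i => ∑ j, (inner ℝ (B j (x i)) (B j (x i - x'))
      + d i j * inner ℝ (A j (x i)) (A j (x i - x')))) atTop (𝓝 0)) :
    Tendsto x atTop (𝓝 x') := by
  have hw : ∀ ℓ : X →L[ℝ] ℝ, Tendsto (fun i => ℓ (x i - x')) atTop (𝓝 0) := fun ℓ => by
    simpa using (hweak ℓ).sub_const (ℓ x')
  have h1 : ∀ j, Tendsto (fun i => inner ℝ (A j x') (A j (x i - x'))) atTop (𝓝 0) := fun j =>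
    hw ((innerSL ℝ (A j x')).comp (A j))
  have h2 : ∀ j, Tendsto (fun i => inner ℝ (B j x') (B j (x i - x'))) atTop (𝓝 0) := fun j =>
    hw ((innerSL ℝ (B j x')).comp (B j))
  -- The same form with the limit in the first slots vanishes by weak convergence; subtracting it
  -- from `hS` leaves a definite quadratic form in `x i - x'`.
  have h3 : Tendsto (fun i => ∑ j, (inner ℝ (B j x') (B j (x i - x'))
      + d i j * inner ℝ (A j x') (A j (x i - x')))) atTop (𝓝 0) := by
    simpa using tendsto_finsetSum Finset.univ fun j _ => (h2 j).add ((hd j).mul (h1 j))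
  have h4 := hS.sub h3
  rw [sub_zero] at h4
  have h5 : Tendsto (fun i => ‖x i - x'‖ ^ 2) atTop (𝓝 0) := by
    have h6 : Tendsto (fun i => δ⁻¹ * (∑ j, (inner ℝ (B j (x i)) (B j (x i - x'))
        + d i j * inner ℝ (A j (x i)) (A j (x i - x')))
        - ∑ j, (inner ℝ (B j x') (B j (x i - x'))
        + d i j * inner ℝ (A j x') (A j (x i - x'))))) atTop (𝓝 0) := by
      simpa using h4.const_mul δ⁻¹
    refine tendsto_of_tendsto_of_tendsto_of_le_of_le' tendsto_const_nhds h6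
      (Eventually.of_forall fun i => by positivity) ?_
    filter_upwards [hdδ] with i hi
    rw [le_inv_mul_iff₀ hδ, hN, Finset.mul_sum, ← Finset.sum_sub_distrib]
    refine Finset.sum_le_sum fun j _ => ?_
    have e1 : inner ℝ (B j (x i)) (B j (x i - x')) - inner ℝ (B j x') (B j (x i - x'))
        = ‖B j (x i - x')‖ ^ 2 := by
      rw [← inner_sub_left, ← map_sub, real_inner_self_eq_norm_sq]
    have e2 : inner ℝ (A j (x i)) (A j (x i - x')) - inner ℝ (A j x') (A j (x i - x'))
        = ‖A j (x i - x')‖ ^ 2 := by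
      rw [← inner_sub_left, ← map_sub, real_inner_self_eq_norm_sq]
    calc δ * (‖A j (x i - x')‖ ^ 2 + ‖B j (x i - x')‖ ^ 2)
        ≤ d i j * ‖A j (x i - x')‖ ^ 2 + 1 * ‖B j (x i - x')‖ ^ 2 := by
          have := mul_le_mul_of_nonneg_right (hi j) (sq_nonneg ‖A j (x i - x')‖)
          have := mul_le_mul_of_nonneg_right hδ1 (sq_nonneg ‖B j (x i - x')‖)
          linarith
      _ = _ := by
          rw [← e1, ← e2]
          ring
  rw [tendsto_iff_norm_sub_tendsto_zero]
  have h7 := h5.sqrt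
  rw [Real.sqrt_zero] at h7
  refine h7.congr fun i => Real.sqrt_sq (norm_nonneg _)

end

/-! ### Boundedness of Palais–Smale sequences and the potential term -/

section

variable {n k : ℕ} {G : EuclideanSpace ℝ (Fin k) → ℝ} {c p q : ℝ} {m : Fin k → ℝ}

/-- Nonnegativity of `F` bounds the Dirichlet part by the energy. -/
theorem sum_sq_gradL_le (hk : k ≠ 0) {u : H n k} (hG : Integrable fun x => G (val u x))
    (hF : ∀ z, 0 ≤ G z + 1 / 2 * ∑ j, m j ^ 2 * z j ^ 2) (ω : EuclideanSpace ℝ (Fin k)) :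
    ∑ j, ‖gradL n j u‖ ^ 2 ≤ 2 * energy m G (u, ω) := by
  have h1 : Integrable fun x : Rn n => 1 / 2 * ∑ j, m j ^ 2 * comp u j x ^ 2 :=
    (integrable_finsetSum _ fun j _ => (integrable_sq_comp u j).const_mul (m j ^ 2)).const_mul _
  -- Integrated nonnegativity of `F`: the mass terms of the energy compensate a negative `∫ G(u)`.
  have h2 : 0 ≤ ∫ x, (G (val u x) + 1 / 2 * ∑ j, m j ^ 2 * comp u j x ^ 2) :=
    integral_nonneg fun x => hF (val u x)
  rw [integral_add hG h1, integral_const_mul, integral_finsetSum _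
    fun j _ => (integrable_sq_comp u j).const_mul (m j ^ 2)] at h2
  simp_rw [integral_const_mul, integral_sq_comp] at h2
  rw [energy_eq hk hG]
  simp_rw [gradL_apply, compL_apply]
  generalize (∫ x, G (val u x)) = I at h2 ⊢
  generalize ha : (fun j => ‖(u j).1.fst‖) = a
  generalize hb : (fun j => ‖(u j).1.snd‖) = b
  have ha' : ∀ j, ‖(u j).1.fst‖ = a j := fun j => congrFun ha j
  have hb' : ∀ j, ‖(u j).1.snd‖ = b j := fun j => congrFun hb j
  simp_rw [ha'] at h2
  simp_rw [ha', hb']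
  have h3 : ∑ j, b j ^ 2 + ∑ j, m j ^ 2 * a j ^ 2
      ≤ ∑ j, (b j ^ 2 + (m j ^ 2 + ω j ^ 2) * a j ^ 2) := by
    rw [← Finset.sum_add_distrib]
    exact Finset.sum_le_sum fun j _ => by nlinarith [mul_nonneg (sq_nonneg (ω j)) (sq_nonneg (a j))]
  linarith

theorem exists_mul_rpow_add_rpow_le (c : ℝ) {s t ε : ℝ} (hs : 0 < s) (ht : 0 < t) (hε : 0 < ε) :
    ∃ T : ℝ, 0 < T ∧ c * (T ^ s + T ^ t) ≤ ε := by
  have h1 : Tendsto (fun T : ℝ => c * (T ^ s + T ^ t)) (𝓝[>] 0) (𝓝 (c * (0 ^ s + 0 ^ t))) :=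
    (((Real.continuousAt_rpow_const 0 s (Or.inr hs.le)).add
      (Real.continuousAt_rpow_const 0 t (Or.inr ht.le))).const_mul c).mono_left nhdsWithin_le_nhds
  rw [Real.zero_rpow hs.ne', Real.zero_rpow ht.ne', add_zero, mul_zero] at h1
  obtain ⟨T, hT, hT0⟩ := ((h1.eventually (ge_mem_nhds hε)).and self_mem_nhdsWithin).exists
  exact ⟨T, hT0, hT⟩

/-- On sets with bounded gradients the potential terms are controlled by an arbitrarily small
multiple of the square of the `L²` norm, up to a constant. -/
theorem exists_potential_le (hn : 3 ≤ n) (hc : 0 ≤ c) (hp : 2 < p) (hpq : p ≤ q)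
    (hq : q < critExp n) {ε : ℝ} (hε : 0 < ε) (R : ℝ) : ∃ D : ℝ, 0 ≤ D ∧ ∀ u : H n k,
      ∑ j, ‖gradL n j u‖ ^ 2 ≤ R → c * ((∫ x, ‖val u x‖ ^ p) + ∫ x, ‖val u x‖ ^ q)
        ≤ ε * ∑ j, ‖compL n j u‖ ^ 2 + D := by
  obtain ⟨C, hC0, hC⟩ := exists_integral_critExp_le hn k
  -- Since `p, q > 2`, a small interpolation level makes the coefficient of the `L²` term at most
  -- `ε`; the critical term is bounded by Sobolev's inequality and the gradient bound.
  obtain ⟨T, hT, hTε⟩ := exists_mul_rpow_add_rpow_le c (s := p - 2) (t := q - 2) (by linarith)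
    (by linarith) hε
  have h2r := two_lt_critExp hn
  simp_rw [gradL_apply, compL_apply]
  set L : ℝ := (C * (k * Real.sqrt R)) ^ critExp n with hL
  have hL0 : 0 ≤ L := by positivity
  refine ⟨c * (T ^ (p - critExp n) + T ^ (q - critExp n)) * L, by positivity, fun u hu => ?_⟩
  have h1 : ∫ x, ‖val u x‖ ^ critExp n ≤ L := by
    refine (hC u).trans (Real.rpow_le_rpow (mul_nonneg hC0 (Finset.sum_nonneg fun j _ =>
      norm_nonneg _)) (mul_le_mul_of_nonneg_left ?_ hC0) (by linarith))
    have h3 : ∀ j ∈ Finset.univ, ‖(u j).1.snd‖ ≤ Real.sqrt R := fun j hj =>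
      Real.le_sqrt_of_sq_le ((Finset.single_le_sum (f := fun j => ‖(u j).1.snd‖ ^ 2)
        (fun i _ => sq_nonneg _) hj).trans hu)
    exact (Finset.sum_le_card_nsmul _ _ _ h3).trans_eq (by simp)
  have h4 := integral_rpow_val_le hn hp.le (hpq.trans hq.le) u hT
  have h5 := integral_rpow_val_le hn (hp.le.trans hpq) hq.le u hT
  have h6 : ∫ x, ‖val u x‖ ^ 2 = ∑ j, ‖(u j).1.fst‖ ^ 2 := integral_sq_val u
  have h7 : 0 ≤ ∑ j, ‖(u j).1.fst‖ ^ 2 := Finset.sum_nonneg fun j _ => sq_nonneg _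
  rw [h6] at h4 h5
  generalize (∑ j, ‖(u j).1.fst‖ ^ 2) = a at *
  generalize (∫ x, ‖val u x‖ ^ critExp n) = b at *
  generalize (∫ x, ‖val u x‖ ^ p) = P at *
  generalize (∫ x, ‖val u x‖ ^ q) = Q at *
  have e1 : 0 ≤ T ^ (p - critExp n) := by positivity
  have e2 : 0 ≤ T ^ (q - critExp n) := by positivity
  calc c * (P + Q) ≤ c * ((T ^ (p - 2) * a + T ^ (p - critExp n) * L)
        + (T ^ (q - 2) * a + T ^ (q - critExp n) * L)) := by
        refine mul_le_mul_of_nonneg_left (add_le_add (h4.trans ?_) (h5.trans ?_)) hc <;> gcongr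
    _ = c * (T ^ (p - 2) + T ^ (q - 2)) * a
        + c * (T ^ (p - critExp n) + T ^ (q - critExp n)) * L := by ring
    _ ≤ _ := by gcongr

theorem rpow_div_mul_rpow_one_div {a s : ℝ} (ha : 0 ≤ a) (hs : 1 < s) :
    a ^ ((s - 1) / s) * a ^ (1 / s) = a := by
  have hs0 : s ≠ 0 := by linarith
  have h : (s - 1) / s + 1 / s = 1 := by field_simp; ring
  rw [← Real.rpow_add' ha (by rw [h]; exact one_ne_zero), h, Real.rpow_one]

/-- In the application `a` and `b` are the squared `L²` norms of `u` and `Du`, and `N = ‖u‖`. Half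
of `δ a` absorbs the potential term, so `a ≤ (2/δ)(N + D)`; thus `N²` is bounded by an affine
function of `N`. -/
theorem le_of_firstVariation {a b S I N δ D R : ℝ} (hb : 0 ≤ b)
    (hN : N ^ 2 = a + b) (hδ : 0 < δ) (hS : δ * a ≤ S) (h : |b + S + I| ≤ N)
    (hI : |I| ≤ δ / 2 * a + D) (hD : 0 ≤ D) (hR : b ≤ R) :
    N ≤ 1 + R + 2 / δ * (1 + D) := by
  have h1 := (abs_le.1 h).2
  have h2 := (abs_le.1 hI).1
  have h3 : a ≤ 2 / δ * (N + D) := by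
    rw [div_mul_eq_mul_div, le_div_iff₀ hδ]
    linarith
  have hR0 : 0 ≤ R := hb.trans hR
  have hd : 0 < 2 / δ := by positivity
  generalize 2 / δ = e at *
  by_contra! hc
  have h5 : 0 ≤ e * (1 + D) := by positivity
  have h4 : 1 < N := by linarith
  have h6 : N * (1 + R + e * (1 + D)) < N * N := mul_lt_mul_of_pos_left hc (by linarith)
  nlinarith [mul_nonneg hR0 (sub_nonneg.2 h4.le), mul_nonneg (mul_nonneg hd.le hD)
    (sub_nonneg.2 h4.le)]


theorem eventually_mul_le_of_tendsto_zero {ε : ℕ → ℝ} (hε : Tendsto ε atTop (𝓝 0)) (K : ℝ) :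
    ∀ᶠ i in atTop, ε i * K ≤ 1 := by
  have h := hε.mul_const K
  rw [zero_mul] at h
  exact h.eventually (ge_mem_nhds one_pos)

theorem exists_norm_le {u : ℕ → H n k} {ω : ℕ → EuclideanSpace ℝ (Fin k)} {σ : Fin k → ℝ}
    (hk : k ≠ 0) (hn : 3 ≤ n) (hG : ContDiff ℝ 1 G) (hG0 : G 0 = 0)
    (hF : ∀ z, 0 ≤ G z + 1 / 2 * ∑ j, m j ^ 2 * z j ^ 2)
    (hc : 0 ≤ c) (hp : 2 < p) (hpq : p ≤ q) (hq : q < critExp n)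
    (hDG : ∀ z, ‖fderiv ℝ G z‖ ≤ c * (‖z‖ ^ (p - 1) + ‖z‖ ^ (q - 1)))
    (hσ : ∀ j, 0 < σ j) (hPS : IsPalaisSmale m G σ fun i => (u i, ω i)) {W δ : ℝ}
    (hW : ∀ i j, ω i j ≤ W) (hδ : 0 < δ)
    (hdδ : ∀ᶠ i in atTop, ∀ j, δ ≤ m j ^ 2 - ω i j ^ 2) : ∃ M : ℝ, ∀ i, ‖u i‖ ≤ M := by
  obtain ⟨hz, ⟨B, hB⟩, hε⟩ := hPS
  have hR : ∀ i, ∑ j, ‖gradL n j (u i)‖ ^ 2 ≤ 2 * B := fun i =>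
    (sum_sq_gradL_le hk (integrable_potential hn hG hG0 hc hp hpq hq hDG (u i)) hF (ω i)).trans
      (mul_le_mul_of_nonneg_left (abs_le.1 (hB i)).2 two_pos.le)
  obtain ⟨D, hD0, hD⟩ := exists_potential_le (k := k) hn hc hp hpq hq (half_pos hδ) (2 * B)
  have hev : ∀ᶠ i in atTop, ‖u i‖ ≤ 1 + 2 * B + 2 / δ * (1 + D) := by
    filter_upwards [hdδ, eventually_mul_le_of_tendsto_zero hε
      (1 + ∑ j, 2 * Real.sqrt (W ^ 3 / σ j))] with i hi h1
    -- The test vector is `u i` itself, which is radial.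
    obtain ⟨I, hI, h2⟩ := exists_bound_firstVariation hk hn hG hG0 hc hp hpq hq hDG hσ (hz i)
      (hW i) (hz i).1
    have h3 := (integrable_fderiv_potential hn hG hc hp hpq hq hDG (u i) (u i)).2
    rw [rpow_div_mul_rpow_one_div (integral_nonneg fun x => by positivity) (by linarith),
      rpow_div_mul_rpow_one_div (integral_nonneg fun x => by positivity) (by linarith),
      ← hI] at h3
    have h4 := h3.trans (hD (u i) (hR i))
    have h5 : δ * ∑ j, ‖compL n j (u i)‖ ^ 2
        ≤ ∑ j, (m j ^ 2 - ω i j ^ 2) * ‖compL n j (u i)‖ ^ 2 := by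
      rw [Finset.mul_sum]
      exact Finset.sum_le_sum fun j _ => mul_le_mul_of_nonneg_right (hi j) (sq_nonneg _)
    have h6 : ‖u i‖ ^ 2 = ∑ j, ‖compL n j (u i)‖ ^ 2 + ∑ j, ‖gradL n j (u i)‖ ^ 2 := by
      rw [norm_sq_eq_sum, Finset.sum_add_distrib]
    simp_rw [real_inner_self_eq_norm_sq, Finset.sum_add_distrib] at h2
    rw [← mul_assoc] at h2
    exact le_of_firstVariation (Finset.sum_nonneg fun j _ => sq_nonneg _) h6 hδ h5
      (h2.trans (mul_le_of_le_one_left (norm_nonneg _) h1)) h4 hD0 (hR i)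
  obtain ⟨N, hN⟩ := eventually_atTop.1 hev
  refine ⟨∑ i ∈ Finset.range N, ‖u i‖ + |1 + 2 * B + 2 / δ * (1 + D)|, fun i => ?_⟩
  have h0 : 0 ≤ ∑ i ∈ Finset.range N, ‖u i‖ := Finset.sum_nonneg fun i _ => norm_nonneg _
  rcases lt_or_ge i N with h | h
  · have := Finset.single_le_sum (f := fun i => ‖u i‖) (fun i _ => norm_nonneg _)
      (Finset.mem_range.2 h)
    have h7 := abs_nonneg (1 + 2 * B + 2 / δ * (1 + D))
    exact this.trans (le_add_of_nonneg_right h7)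
  · exact ((hN i h).trans (le_abs_self _)).trans (le_add_of_nonneg_left h0)

/-- By Hölder the integral is at most a sum of products of `‖u‖_s ^ (s - 1)`, bounded by the
embedding, and `‖w‖_s`, which tends to zero, for `s = p, q`. -/
theorem tendsto_fderiv_potential (hn : 3 ≤ n) (hG : ContDiff ℝ 1 G) (hc : 0 ≤ c)
    (hp : 2 < p) (hpq : p ≤ q) (hq : q < critExp n)
    (hDG : ∀ z, ‖fderiv ℝ G z‖ ≤ c * (‖z‖ ^ (p - 1) + ‖z‖ ^ (q - 1))) {u w : ℕ → H n k} {M : ℝ}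
    (hM : ∀ i, ‖u i‖ ≤ M)
    (hw : ∀ s, 2 < s → s < critExp n → Tendsto (fun i => ∫ x, ‖val (w i) x‖ ^ s) atTop (𝓝 0)) :
    Tendsto (fun i => ∫ x, fderiv ℝ G (val (u i) x) (val (w i) x)) atTop (𝓝 0) := by
  have key : ∀ s, 2 < s → s < critExp n → ∃ K : ℝ, Tendsto (fun i => K *
      (∫ x, ‖val (w i) x‖ ^ s) ^ (1 / s)) atTop (𝓝 0) ∧ ∀ i,
      (∫ x, ‖val (u i) x‖ ^ s) ^ ((s - 1) / s) ≤ K := by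
    intro s hs hsr
    obtain ⟨C, hC0, hC⟩ := exists_integral_rpow_val_le hn k hs.le hsr.le
    refine ⟨(C * M ^ s) ^ ((s - 1) / s), ?_, fun i => ?_⟩
    · have h := ((hw s hs hsr).rpow_const (p := 1 / s) (Or.inr (by positivity))).const_mul
        ((C * M ^ s) ^ ((s - 1) / s))
      rwa [Real.zero_rpow (by positivity), mul_zero] at h
    · refine Real.rpow_le_rpow (integral_nonneg fun x => by positivity) ((hC (u i)).trans ?_)
        (div_nonneg (by linarith) (by linarith))
      exact mul_le_mul_of_nonneg_left
        (Real.rpow_le_rpow (norm_nonneg _) (hM i) (by linarith)) hC0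
  obtain ⟨K₁, hK₁, hK₁'⟩ := key p hp (hpq.trans_lt hq)
  obtain ⟨K₂, hK₂, hK₂'⟩ := key q (hp.trans_le hpq) hq
  have h := (hK₁.add hK₂).const_mul c
  rw [add_zero, mul_zero] at h
  refine squeeze_zero_norm (fun i => ?_) h
  rw [Real.norm_eq_abs]
  refine (integrable_fderiv_potential hn hG hc hp hpq hq hDG (u i) (w i)).2.trans
    (mul_le_mul_of_nonneg_left (add_le_add ?_ ?_) hc)
  · exact mul_le_mul_of_nonneg_right (hK₁' i)
      (Real.rpow_nonneg (integral_nonneg fun x => by positivity) _)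
  · exact mul_le_mul_of_nonneg_right (hK₂' i)
      (Real.rpow_nonneg (integral_nonneg fun x => by positivity) _)

end

/-! ### Strong convergence of the subsequence -/

section

variable {n k : ℕ} {G : EuclideanSpace ℝ (Fin k) → ℝ} {c p q : ℝ} {m : Fin k → ℝ}

theorem exists_weak_subseq_radial {x : ℕ → H n k} {M : ℝ} (hM : ∀ i, ‖x i‖ ≤ M)
    (hx : ∀ i, x i ∈ radial n k) : ∃ s : ℕ → ℕ, StrictMono s ∧ ∃ x' ∈ radial n k,
      ∀ ℓ : H n k →L[ℝ] ℝ, Tendsto (fun i => ℓ (x (s i))) atTop (𝓝 (ℓ x')) := by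
  let _ : InnerProductSpace ℝ (H n k) := PiLp.innerProductSpace _
  obtain ⟨s, hs, x', hx'⟩ := exists_weak_subseq (X := H n k) hM
  exact ⟨s, hs, x', mem_of_weak_limit isClosed_radial (fun i => hx (s i)) hx', hx'⟩

theorem tendsto_inner_comp_sub {x : ℕ → H n k} {x' : H n k}
    (h : ∀ ℓ : H n k →L[ℝ] ℝ, Tendsto (fun i => ℓ (x i)) atTop (𝓝 (ℓ x'))) (j : Fin k)
    (v : Lp ℝ 2 (volume : Measure (Rn n))) :
    Tendsto (fun i => inner ℝ ((x i - x') j).1.fst v) atTop (𝓝 0) := by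
  have h1 := (h ((innerSL ℝ v).comp (compL n j))).sub_const (((innerSL ℝ v).comp (compL n j)) x')
  rw [sub_self] at h1
  refine h1.congr fun i => ?_
  rw [← map_sub, ContinuousLinearMap.comp_apply, innerSL_apply_apply, real_inner_comm,
    compL_apply]

/-- The strict inequality in the gap is inherited by sequences converging to `b`; `δ ≤ 1` is
required because the gradient part of the quadratic form has coefficient `1`. -/
theorem exists_gap {a b : Fin k → ℝ} (hb : ∀ j, 0 ≤ b j) (h : ∀ j, b j < a j) :
    ∃ δ : ℝ, 0 < δ ∧ δ ≤ 1 ∧ ∀ j, δ < a j ^ 2 - b j ^ 2 := by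
  have h1 : ∀ᶠ δ in 𝓝[>] (0 : ℝ), ∀ j, δ < a j ^ 2 - b j ^ 2 := by
    rw [eventually_all]
    refine fun j => mem_nhdsWithin_of_mem_nhds (gt_mem_nhds ?_)
    nlinarith [h j, hb j]
  obtain ⟨δ, ⟨h2, h3⟩, h4⟩ := ((h1.and (mem_nhdsWithin_of_mem_nhds
    (ge_mem_nhds one_pos))).and self_mem_nhdsWithin).exists
  exact ⟨δ, h4, h3, h2⟩

theorem tendsto_zero_of_abs_le {f ε N : ℕ → ℝ} {K M : ℝ} (hε : Tendsto ε atTop (𝓝 0))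
    (hK : 0 ≤ K) (hN : ∀ i, 0 ≤ N i) (hM : ∀ i, N i ≤ M) (h : ∀ i, |f i| ≤ ε i * (K * N i)) :
    Tendsto f atTop (𝓝 0) := by
  have h1 := hε.abs.mul_const (K * M)
  rw [abs_zero, zero_mul] at h1
  exact squeeze_zero_norm (fun i => ((h i).trans (mul_le_mul_of_nonneg_right (le_abs_self _)
    (mul_nonneg hK (hN i)))).trans (mul_le_mul_of_nonneg_left
    (mul_le_mul_of_nonneg_left (hM i) hK) (abs_nonneg _))) h1

set_option maxHeartbeats 1000000 in
theorem tendsto_firstVariation {u w : ℕ → H n k} {ω : ℕ → EuclideanSpace ℝ (Fin k)}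
    {σ : Fin k → ℝ} {W M : ℝ}
    (hk : k ≠ 0) (hn : 3 ≤ n) (hG : ContDiff ℝ 1 G) (hG0 : G 0 = 0)
    (hc : 0 ≤ c) (hp : 2 < p) (hpq : p ≤ q) (hq : q < critExp n)
    (hDG : ∀ z, ‖fderiv ℝ G z‖ ≤ c * (‖z‖ ^ (p - 1) + ‖z‖ ^ (q - 1))) (hσ : ∀ j, 0 < σ j)
    (hz : ∀ i, (u i, ω i) ∈ constraintRadial n σ)
    (hE : Tendsto (fun i => ‖(fderiv ℝ (energy m G) (u i, ω i)).comp
      (tangent (u i, ω i)).subtypeL‖) atTop (𝓝 0))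
    (hW : ∀ i j, ω i j ≤ W) (hw : ∀ i, w i ∈ radial n k) (hM : ∀ i, ‖w i‖ ≤ M) :
    Tendsto (fun i => ∑ j, (inner ℝ (gradL n j (u i)) (gradL n j (w i))
      + (m j ^ 2 - ω i j ^ 2) * inner ℝ (compL n j (u i)) (compL n j (w i)))
      + ∫ x, fderiv ℝ G (val (u i) x) (val (w i) x)) atTop (𝓝 0) := by
  have hK : 0 ≤ 1 + ∑ j, 2 * Real.sqrt (W ^ 3 / σ j) :=
    add_nonneg zero_le_one (Finset.sum_nonneg fun j _ => by positivity)
  refine tendsto_zero_of_abs_le hE hK (fun i => norm_nonneg (w i)) hM (fun i => ?_)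
  obtain ⟨I, hI, h⟩ := exists_bound_firstVariation hk hn hG hG0 hc hp hpq hq hDG hσ
    (hz i) (hW i) (hw i)
  subst hI
  exact h

theorem exists_tendsto_of_isPalaisSmale {u : ℕ → H n k} {ω : ℕ → EuclideanSpace ℝ (Fin k)}
    {σ : Fin k → ℝ} {ω' : EuclideanSpace ℝ (Fin k)}
    (hk : k ≠ 0) (hn : 3 ≤ n) (hG : ContDiff ℝ 1 G) (hG0 : G 0 = 0)
    (hF : ∀ z, 0 ≤ G z + 1 / 2 * ∑ j, m j ^ 2 * z j ^ 2)
    (hc : 0 ≤ c) (hp : 2 < p) (hpq : p ≤ q) (hq : q < critExp n)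
    (hDG : ∀ z, ‖fderiv ℝ G z‖ ≤ c * (‖z‖ ^ (p - 1) + ‖z‖ ^ (q - 1)))
    (hσ : ∀ j, 0 < σ j) (hPS : IsPalaisSmale m G σ fun i => (u i, ω i))
    (hω : Tendsto ω atTop (𝓝 ω')) (hω' : ∀ j, ω' j < m j) :
    ∃ s : ℕ → ℕ, StrictMono s ∧
      ∃ u' ∈ radial n k, Tendsto (fun i => u (s i)) atTop (𝓝 u') := by
  have hωj : ∀ j, Tendsto (fun i => ω i j) atTop (𝓝 (ω' j)) := fun j =>
    ((EuclideanSpace.proj (𝕜 := ℝ) j).continuous.tendsto ω').comp hω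
  have hd : ∀ j, Tendsto (fun i => m j ^ 2 - ω i j ^ 2) atTop (𝓝 (m j ^ 2 - ω' j ^ 2)) := fun j =>
    ((hωj j).pow 2).const_sub _
  obtain ⟨δ, hδ, hδ1, hδ2⟩ := exists_gap
    (fun j => ge_of_tendsto' (hωj j) fun i => (hPS.1 i).2.1 j) hω'
  have hdδ : ∀ᶠ i in atTop, ∀ j, δ ≤ m j ^ 2 - ω i j ^ 2 :=
    eventually_all.2 fun j => (hd j).eventually (le_mem_nhds (hδ2 j))
  obtain ⟨W, hW⟩ : ∃ W : ℝ, ∀ i j, ω i j ≤ W := by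
    obtain ⟨W, hW⟩ := hω.norm.bddAbove_range
    exact ⟨W, fun i j => ((le_abs_self _).trans (PiLp.norm_apply_le (ω i) j)).trans
      (hW ⟨i, rfl⟩)⟩
  obtain ⟨M, hM⟩ := exists_norm_le hk hn hG hG0 hF hc hp hpq hq hDG hσ hPS hW hδ hdδ
  obtain ⟨s, hs, u', hrad, hu'⟩ := exists_weak_subseq_radial hM fun i => (hPS.1 i).1
  refine ⟨s, hs, u', hrad, ?_⟩
  have hwr : ∀ i, u (s i) - u' ∈ radial n k := fun i =>
    (radial n k).sub_mem (hPS.1 (s i)).1 hrad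
  have hwM : ∀ i, ‖u (s i) - u'‖ ≤ M + ‖u'‖ := fun i =>
    (norm_sub_le _ _).trans (add_le_add (hM _) le_rfl)
  -- The compact embedding applies to `u (s i) - u'`, which is radial, bounded and weakly null.
  have hI := tendsto_fderiv_potential hn hG hc hp hpq hq hDG (fun i => hM (s i))
    fun t ht htr => tendsto_integral_rpow_val hn ht htr hwr hwM (tendsto_inner_comp_sub hu')
  refine tendsto_of_quadratic (A := compL n) (B := gradL n) norm_sq_eq_sum
    (d := fun i j => m j ^ 2 - ω (s i) j ^ 2) (d' := fun j => m j ^ 2 - ω' j ^ 2)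
    (fun j => (hd j).comp hs.tendsto_atTop) hδ hδ1 (hs.tendsto_atTop.eventually hdδ) hu' ?_
  have h := (tendsto_firstVariation hk hn hG hG0 hc hp hpq hq hDG hσ (fun i => hPS.1 (s i))
    (hPS.2.2.comp hs.tendsto_atTop) (fun i => hW (s i)) hwr hwM).sub hI
  rw [sub_zero] at h
  exact h.congr fun i => add_sub_cancel_right _ _

end

end EllipticSystem

end

theorem mainTheorem3 (n k : ℕ) (hn : 3 ≤ n) (m : Fin k → ℝ) (hm : ∀ j, 0 < m j)
    (G : EuclideanSpace ℝ (Fin k) → ℝ) (hG : ContDiff ℝ 1 G)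
    (hG_zero : G 0 = 0)
    (hF : ∀ z, 0 ≤ G z + 1 / 2 * ∑ j, m j ^ 2 * z j ^ 2)
    (c p q : ℝ) (hp : 2 < p) (hpq : p ≤ q) (hq : q < 2 * (n : ℝ) / ((n : ℝ) - 2))
    (hDG : ∀ z, ‖fderiv ℝ G z‖ ≤ c * (‖z‖ ^ (p - 1) + ‖z‖ ^ (q - 1)))
    (σ : Fin k → ℝ) (hσ : ∀ j, 0 < σ j)
    (u : ℕ → EllipticSystem.H n k) (ω : ℕ → EuclideanSpace ℝ (Fin k))
    (hPS : EllipticSystem.IsPalaisSmale m G σ (fun i => (u i, ω i)))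
    (ω' : EuclideanSpace ℝ (Fin k)) (hω : Tendsto ω atTop (𝓝 ω')) (hω' : ∀ j, ω' j < m j) :
    ∃ s : ℕ → ℕ, StrictMono s ∧
      ∃ u' ∈ EllipticSystem.radial n k, Tendsto (fun i => u (s i)) atTop (𝓝 u') := by
  -- For `k = 0` the space `H` is trivial, and the rewriting of the energy with `k⁻¹` is not
  -- available.
  rcases eq_or_ne k 0 with rfl | hk
  · refine ⟨id, strictMono_id, 0, Submodule.zero_mem _, ?_⟩
    have h : ∀ i, u (id i) = 0 := fun i => by
      ext j
      exact j.elim0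
    simp only [h]
    exact tendsto_const_nhds
  -- The sign of `c` is not prescribed, so `c` is replaced by `|c|`.
  · refine EllipticSystem.exists_tendsto_of_isPalaisSmale (c := |c|) hk hn hG hG_zero hF
      (abs_nonneg c) hp hpq hq (fun z => (hDG z).trans ?_) hσ hPS hω hω'
    exact mul_le_mul_of_nonneg_right (le_abs_self c) (by positivity)
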